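/- Let $\mathcal H$ be a complex Hilbert space, $\hbar>0$, and $U(t)=e^{-it\hat H/\hbar}$ a strongly continuous one-parameter unitary group on $\mathcal H$ with Hamiltonian $\hat H$ (so $\hat Hx=i\hbar\frac{d}{dt}U(t)x|_{t=0}$ on the domain $D(\hat H)$ of all $x$ for which the derivative exists). States may be generalized vectors of the rigging $D(\hat H)\subset\mathcal H\subset D(\hat H)^\times$: a generalized vector $\psi$ is an antilinear functional $\varphi\mapsto\langle\varphi|\psi\rangle$ on $D(\hat H)$ that is continuous for the graph norm, and its evolution is $\psi(t)=U(t)\psi$, i.e. $\langle\varphi|\psi(t)\rangle=\langle U(-t)\varphi|\psi\rangle$. The integrals $\int_a^b\psi(t)\,dt$, taken weakly, are vectors of $\mathcal H$. Two generalized states $\chi,\xi$ are called perfectly distinguishable (orthogonal) if $\langle\chi_\varepsilon,\xi_\varepsilon\rangle\to0$ as $\varepsilon\to0^+$, where $\chi_\varepsilon=\frac1\varepsilon\int_0^\varepsilon U(s)\chi\,ds$ and $\xi_\varepsilon=\frac1\varepsilon\int_0^\varepsilon U(s)\xi\,ds$; for vectors of $\mathcal H$ this means $\langle\chi,\xi\rangle=0$.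 Let $\psi\neq0$ be a generalized state such that $\psi(0)$ is perfectly distinguishable from $\psi(t)$ for all $t<0$, or for all $t>0$. Let $\mathcal V\subset\mathcal H$ be the closed linear span of its history, i.e. of the vectors $\int_a^b\psi(t)\,dt$, $a,b\in\mathbb R$. Then $U(t)\mathcal V\subset\mathcal V$ for all $t$, $\hat H$ maps $D(\hat H)\cap\mathcal V$ into $\mathcal V$, and there are a unitary map $W:\mathcal V\to L^2(\mathbb R,\mathbb C)$, a constant $c>0$, and an operator $\hat\tau$ in $\mathcal V$ such that: 1. for every $\varphi\in\mathcal V\cap D(\hat H)$, $(W\varphi)(\tau)=c\,\overline{\langle\varphi|\psi(\tau)\rangle}$ for almost every $\tau$; 2. $W$ carries $\hat H|_{\mathcal V}$ to $-i\hbar\frac{\partial}{\partial\tau}$ with domain the Sobolev space $H^1(\mathbb R)$, and $\hat\tau$ to multiplication by $\tau$ on its maximal domain; 3. $\hat\tau$ is a canonical conjugate of $\hat H|_{\mathcal V}$: both operators are self-adjoint, the domain $D(\hat\tau\hat H|_{\mathcal V})\cap D(\hat H|_{\mathcal V}\hat\tau)$ is dense in $\mathcal V$ and $[\hat\tau,\hat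 H]=i\hbar$ on it, and the Weyl relations $e^{-i\alpha\hat\tau/\hbar}\,e^{-it\hat H/\hbar}=e^{-i\alpha t/\hbar}\,e^{-it\hat H/\hbar}\,e^{-i\alpha\hat\tau/\hbar}$ hold on $\mathcal V$ for all $\alpha,t\in\mathbb R$; 4. for every $\tau\in\mathbb R$, $\psi(\tau)$ is a generalized eigenvector of $\hat\tau$ with eigenvalue $\tau$: $\langle\hat\tau\varphi|\psi(\tau)\rangle=\tau\langle\varphi|\psi(\tau)\rangle$ for all $\varphi\in D(\hat\tau)\cap D(\hat H)$ with $\hat\tau\varphi\in D(\hat H)$, and $\langle\varphi|\psi(\tau)\rangle\neq0$ for some such $\varphi$. In this sense $\hat\tau$ is a time operator. -/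

import Mathlib

open MeasureTheory Filter Topology
open scoped ContDiff InnerProductSpace

noncomputable section

namespace TimeOp

section Evolution

variable {H : Type*} [NormedAddCommGroup H] [InnerProductSpace ℂ H]

/-- A strongly continuous one-parameter group of unitary operators. -/
structure UnitaryGroup (H : Type*) [NormedAddCommGroup H] [InnerProductSpace ℂ H] where
  op : ℝ → (H ≃ₗᵢ[ℂ] H)
  op_add : ∀ s t x, op (s + t) x = op s (op t x)
  continuous_op : ∀ x, Continuous fun t => op t x

/-- The Hamiltonian of the evolution `U`, i.e. the operator with `U t = exp (-i t Ĥ / ħ)`: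
it is `iħ d/dt (U t x)` at `t = 0`, on the domain of all `x` for which this derivative exists. -/
def UnitaryGroup.hamiltonian (U : UnitaryGroup H) (ħ : ℝ) : H →ₗ.[ℂ] H where
  domain :=
    { carrier := {x | DifferentiableAt ℝ (fun t => U.op t x) 0}
      zero_mem' := by simp
      add_mem' := by
        intro x y hx hy
        simpa only [Set.mem_ofPred_eq, map_add] using DifferentiableAt.fun_add hx hy
      smul_mem' := by
        intro c x hx
        simpa only [Set.mem_ofPred_eq, map_smul] using DifferentiableAt.fun_const_smul hx c }
  toFun :=
    { toFun := fun x => (Complex.I * ħ) • deriv (fun t => U.op t (x : H)) 0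
      map_add' := by
        intro x y
        have h := deriv_fun_add x.2 y.2
        simp only [Submodule.coe_add, map_add]
        rw [h, smul_add]
      map_smul' := by
        intro c x
        have h := deriv_fun_const_smul c x.2
        simp only [Submodule.coe_smul, map_smul, RingHom.id_apply]
        rw [h, smul_comm] }

theorem UnitaryGroup.op_comm (U : UnitaryGroup H) (s t : ℝ) (x : H) :
    U.op s (U.op t x) = U.op t (U.op s x) := by
  rw [← U.op_add, ← U.op_add, add_comm]

/-- The domain of the Hamiltonian is invariant under the evolution. -/
theorem UnitaryGroup.op_mem_domain (U : UnitaryGroup H) (ħ t : ℝ) {x : H}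
    (hx : x ∈ (U.hamiltonian ħ).domain) : U.op t x ∈ (U.hamiltonian ħ).domain := by
  have h : DifferentiableAt ℝ (fun s => U.op t (U.op s x)) 0 :=
    ((U.op t).toContinuousLinearEquiv.toContinuousLinearMap.restrictScalars
      ℝ).differentiableAt.comp (0 : ℝ) hx
  change DifferentiableAt ℝ (fun s => U.op s (U.op t x)) 0
  simpa only [U.op_comm _ t] using h

/-- The Hamiltonian commutes with the evolution. -/
theorem UnitaryGroup.hamiltonian_op (U : UnitaryGroup H) (ħ t : ℝ)
    (x : (U.hamiltonian ħ).domain) :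
    U.hamiltonian ħ ⟨U.op t x, U.op_mem_domain ħ t x.2⟩ = U.op t (U.hamiltonian ħ x) := by
  have hx : DifferentiableAt ℝ (fun s => U.op s (x : H)) 0 := x.2
  have h : HasDerivAt (fun s => U.op t (U.op s (x : H)))
      (U.op t (deriv (fun s => U.op s (x : H)) 0)) 0 :=
    ((U.op t).toContinuousLinearEquiv.toContinuousLinearMap.restrictScalars
      ℝ).hasFDerivAt.comp_hasDerivAt (0 : ℝ) hx.hasDerivAt
  change (Complex.I * ħ) • deriv (fun s => U.op s (U.op t (x : H))) 0
    = U.op t ((Complex.I * ħ) • deriv (fun s => U.op s (x : H)) 0)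
  simp only [U.op_comm _ t]
  rw [h.deriv, map_smul]

end Evolution

section Rigging

variable {H : Type*} [NormedAddCommGroup H] [InnerProductSpace ℂ H]

/-- The generalized vectors of the rigging `D(A) ⊆ H ⊆ D(A)ˣ` that belongs to an operator `A`:
continuous antilinear functionals `φ ↦ ⟨φ|ψ⟩` on the domain of `A` with its graph norm.
A vector `v` of `H` is the functional `φ ↦ ⟪φ, v⟫`. -/
structure GeneralizedVector (A : H →ₗ.[ℂ] H) where
  /-- The pairing `φ ↦ ⟨φ|ψ⟩`. -/
  pair : A.domain →ₗ⋆[ℂ] ℂ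
  bounded : ∃ C : ℝ, ∀ φ : A.domain, ‖pair φ‖ ≤ C * (‖(φ : H)‖ + ‖A φ‖)

/-- The state `ψ(t) = U(t) ψ` at time `t`, for a generalized initial state `ψ = ψ(0)`:
`⟨φ|ψ(t)⟩ = ⟨U(-t) φ|ψ⟩`. -/
def UnitaryGroup.evolve (U : UnitaryGroup H) (ħ : ℝ)
    (ψ : GeneralizedVector (U.hamiltonian ħ)) (t : ℝ) :
    GeneralizedVector (U.hamiltonian ħ) where
  pair :=
    { toFun := fun φ => ψ.pair ⟨U.op (-t) φ, U.op_mem_domain ħ (-t) φ.2⟩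
      map_add' := by
        intro x y
        rw [← map_add]
        congr 1
        ext
        simp
      map_smul' := by
        intro c x
        rw [← map_smulₛₗ]
        congr 1
        ext
        simp }
  bounded := by
    obtain ⟨C, hC⟩ := ψ.bounded
    refine ⟨C, fun φ => ?_⟩
    have h := hC ⟨U.op (-t) φ, U.op_mem_domain ħ (-t) φ.2⟩
    rw [U.hamiltonian_op ħ (-t) φ, LinearIsometryEquiv.norm_map] at h
    simpa using h

/-- The vector `v` of `H` is the integral of `ψ(t)` over `a ≤ t ≤ b`, in the weak sense. -/
def IsHistoryIntegral (U : UnitaryGroup H) (ħ : ℝ) (ψ : GeneralizedVector (U.hamiltonian ħ))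
    (a b : ℝ) (v : H) : Prop :=
  ∀ φ : (U.hamiltonian ħ).domain, ⟪(φ : H), v⟫_ℂ = ∫ t in a..b, (U.evolve ħ ψ t).pair φ

/-- Orthogonality (perfect distinguishability) of two possibly generalized states `χ` and `ξ`:
with the averages `χ_ε = ε⁻¹ ∫_0^ε χ(s) ds` and `ξ_ε = ε⁻¹ ∫_0^ε ξ(s) ds`, which exist as vectors
of `H` and are unique, `⟪χ_ε, ξ_ε⟫` tends to `0` as `ε → 0+`. If `χ` and `ξ` are vectors of `H`,
then `χ_ε → χ` and `ξ_ε → ξ`, so that this says `⟪χ, ξ⟫ = 0`. -/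
def Distinguishable (U : UnitaryGroup H) (ħ : ℝ)
    (χ ξ : GeneralizedVector (U.hamiltonian ħ)) : Prop :=
  ∃ x y : ℝ → H,
    (∀ ε > 0, IsHistoryIntegral U ħ χ 0 ε (x ε) ∧ IsHistoryIntegral U ħ ξ 0 ε (y ε)) ∧
    Tendsto (fun ε : ℝ => ⟪(ε : ℂ)⁻¹ • x ε, (ε : ℂ)⁻¹ • y ε⟫_ℂ) (𝓝[>] 0) (𝓝 0)

/-- The history space: the closed linear span in `H` of the states `ψ(t)`, `t ∈ ℝ`, where a
generalized state enters through its integrals over bounded time intervals. -/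
def historySpace (U : UnitaryGroup H) (ħ : ℝ) (ψ : GeneralizedVector (U.hamiltonian ħ)) :
    Submodule ℂ H :=
  (Submodule.span ℂ {v | ∃ a b, IsHistoryIntegral U ħ ψ a b v}).topologicalClosure

instance historySpace_complete [CompleteSpace H] (U : UnitaryGroup H) (ħ : ℝ)
    (ψ : GeneralizedVector (U.hamiltonian ħ)) : CompleteSpace (historySpace U ħ ψ) :=
  Submodule.topologicalClosure.completeSpace _

end Rigging

section Operators

variable {H : Type*} [NormedAddCommGroup H] [InnerProductSpace ℂ H]

/-- The restriction of an operator `A` of `H` to a subspace `V`, as an operator of `V`: its graph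
consists of the pairs of vectors of `V` in the graph of `A`. -/
def restrictTo (A : H →ₗ.[ℂ] H) (V : Submodule ℂ H) : V →ₗ.[ℂ] V :=
  (A.graph.comap (V.subtype.prodMap V.subtype)).toLinearPMap

theorem mem_graph_restrictTo (A : H →ₗ.[ℂ] H) (V : Submodule ℂ H) (x y : V) :
    (x, y) ∈ (restrictTo A V).graph ↔ ((x : H), (y : H)) ∈ A.graph := by
  unfold restrictTo
  rw [Submodule.toLinearPMap_graph_eq]
  · simp
  · rintro ⟨u, v⟩ h hu
    have h' : ((u : H), (v : H)) ∈ A.graph := by simpa using h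
    have hu' : u = 0 := hu
    ext
    exact A.graph_fst_eq_zero_snd h' (by simp [hu'])

/-- The Hilbert space `L²(ℝ, ℂ)`. -/
abbrev L2 : Type := Lp ℂ 2 (volume : Measure ℝ)

theorem integrable_testFunction_smul (f : L2) {η : ℝ → ℝ} (hη : Continuous η)
    (hs : HasCompactSupport η) : Integrable fun τ => η τ • f τ :=
  ((Lp.memLp f).locallyIntegrable one_le_two).integrable_smul_left_of_hasCompactSupport hη hs

/-- The pairs `(f, g)` in `L²(ℝ)` with `g = -iħ f'` in the sense of weak derivatives. -/
def translationGraph (ħ : ℝ) : Submodule ℂ (L2 × L2) where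
  carrier := {p | ∀ η : ℝ → ℝ, ContDiff ℝ ∞ η → HasCompactSupport η →
    ∫ τ, η τ • p.2 τ = (Complex.I * ħ) * ∫ τ, deriv η τ • p.1 τ}
  zero_mem' := by
    intro η hη hs
    have h : ∀ θ : ℝ → ℝ, ∫ τ, θ τ • (0 : L2) τ = 0 := by
      intro θ
      rw [integral_congr_ae (g := fun _ => (0 : ℂ)), integral_zero]
      filter_upwards [Lp.coeFn_zero ℂ 2 (volume : Measure ℝ)] with τ hτ
      simp
    simp only [Prod.fst_zero, Prod.snd_zero, h, mul_zero]
  add_mem' := by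
    rintro ⟨f, g⟩ ⟨f', g'⟩ h h' η hη hs
    have key : ∀ (θ : ℝ → ℝ), Continuous θ → HasCompactSupport θ → ∀ u v : L2,
        ∫ τ, θ τ • (u + v : L2) τ = (∫ τ, θ τ • u τ) + ∫ τ, θ τ • v τ := by
      intro θ hθ hc u v
      rw [← integral_add (integrable_testFunction_smul u hθ hc)
        (integrable_testFunction_smul v hθ hc)]
      refine integral_congr_ae ?_
      filter_upwards [Lp.coeFn_add u v] with τ hτ
      rw [hτ, Pi.add_apply, smul_add]
    have h1 := h η hη hs
    have h2 := h' η hη hs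
    simp only [Prod.mk_add_mk] at h1 h2 ⊢
    rw [key _ hη.continuous hs, key _ (hη.continuous_deriv (by simp)) hs.deriv, h1, h2, mul_add]
  smul_mem' := by
    rintro c ⟨f, g⟩ h η hη hs
    have key : ∀ (θ : ℝ → ℝ) (u : L2), ∫ τ, θ τ • (c • u : L2) τ = c * ∫ τ, θ τ • u τ := by
      intro θ u
      rw [← integral_const_mul]
      refine integral_congr_ae ?_
      filter_upwards [Lp.coeFn_smul c u] with τ hτ
      simp only [hτ, Pi.smul_apply, smul_eq_mul, Complex.real_smul]
      ring
    have h1 := h η hη hs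
    simp only [Prod.smul_mk] at h1 ⊢
    rw [key, key, h1]
    ring

/-- The operator `-iħ ∂/∂τ` of `L²(ℝ)`, on the Sobolev space `H¹(ℝ)`. -/
def translationHamiltonian (ħ : ℝ) : L2 →ₗ.[ℂ] L2 := (translationGraph ħ).toLinearPMap

theorem translationHamiltonian_graph (ħ : ℝ) :
    (translationHamiltonian ħ).graph = translationGraph ħ := by
  refine Submodule.toLinearPMap_graph_eq _ ?_
  rintro ⟨f, g⟩ h hf
  have hf' : f = 0 := hf
  subst hf'
  have h0 : ∀ᵐ τ, (g : ℝ → ℂ) τ = 0 := by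
    refine ae_eq_zero_of_integral_contDiff_smul_eq_zero
      ((Lp.memLp g).locallyIntegrable one_le_two) fun η hη hs => ?_
    have := h η hη hs
    rw [this, integral_congr_ae (g := fun _ => (0 : ℂ)), integral_zero, mul_zero]
    filter_upwards [Lp.coeFn_zero ℂ 2 (volume : Measure ℝ)] with τ hτ
    simp
  exact (Lp.eq_zero_iff_ae_eq_zero).2 h0

/-- The pairs `(f, g)` in `L²(ℝ)` with `g(τ) = τ f(τ)`. -/
def positionGraph : Submodule ℂ (L2 × L2) where
  carrier := {p | ∀ᵐ τ : ℝ, p.2 τ = (τ : ℂ) * p.1 τ}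
  zero_mem' := by
    filter_upwards [Lp.coeFn_zero ℂ 2 (volume : Measure ℝ)] with τ hτ
    simp
  add_mem' := by
    rintro ⟨f, g⟩ ⟨f', g'⟩ h h'
    filter_upwards [h, h', Lp.coeFn_add f f', Lp.coeFn_add g g'] with τ h1 h2 h3 h4
    simp only [Prod.mk_add_mk] at h1 h2 ⊢
    rw [h3, h4, Pi.add_apply, Pi.add_apply, h1, h2, mul_add]
  smul_mem' := by
    rintro c ⟨f, g⟩ h
    filter_upwards [h, Lp.coeFn_smul c f, Lp.coeFn_smul c g] with τ h1 h3 h4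
    simp only [Prod.smul_mk] at h1 ⊢
    rw [h3, h4, Pi.smul_apply, Pi.smul_apply, h1, smul_eq_mul, smul_eq_mul]
    ring

/-- The operator of multiplication by `τ` in `L²(ℝ)`, on its maximal domain. -/
def positionOperator : L2 →ₗ.[ℂ] L2 := positionGraph.toLinearPMap

theorem positionOperator_graph : positionOperator.graph = positionGraph := by
  refine Submodule.toLinearPMap_graph_eq _ ?_
  rintro ⟨f, g⟩ h hf
  have hf' : f = 0 := hf
  subst hf'
  refine (Lp.eq_zero_iff_ae_eq_zero).2 ?_
  filter_upwards [h, Lp.coeFn_zero ℂ 2 (volume : Measure ℝ)] with τ h1 h2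
  simpa using h1.trans (by rw [h2]; simp)

/-- The unitary map `W` carries the operator `A` to the operator `B`, domains included. -/
def Represents {K L : Type*} [NormedAddCommGroup K] [InnerProductSpace ℂ K]
    [NormedAddCommGroup L] [InnerProductSpace ℂ L] (W : K ≃ₗᵢ[ℂ] L)
    (A : K →ₗ.[ℂ] K) (B : L →ₗ.[ℂ] L) : Prop :=
  ∀ x y : K, (x, y) ∈ A.graph ↔ (W x, W y) ∈ B.graph

/-- `T` is canonically conjugate to `A`: both are self-adjoint, `[T, A] = iħ` on a dense subspace,
and `S(α) = exp (-i α T / ħ)` and `R(t) = exp (-i t A / ħ)` satisfy the Weyl relations. -/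
structure IsCanonicalConjugate {K : Type*} [NormedAddCommGroup K] [InnerProductSpace ℂ K]
    [CompleteSpace K] (ħ : ℝ) (T A : K →ₗ.[ℂ] K) : Prop where
  selfAdjoint_left : IsSelfAdjoint T
  selfAdjoint_right : IsSelfAdjoint A
  dense_commutator : Dense {x : K | ∃ Tx Ax TAx ATx : K, (x, Tx) ∈ T.graph ∧ (x, Ax) ∈ A.graph ∧
    (Ax, TAx) ∈ T.graph ∧ (Tx, ATx) ∈ A.graph}
  commutator : ∀ x Tx Ax TAx ATx : K, (x, Tx) ∈ T.graph → (x, Ax) ∈ A.graph →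
    (Ax, TAx) ∈ T.graph → (Tx, ATx) ∈ A.graph → TAx - ATx = (Complex.I * ħ) • x
  weyl : ∃ S R : UnitaryGroup K, S.hamiltonian ħ = T ∧ R.hamiltonian ħ = A ∧
    ∀ (α t : ℝ) (x : K), S.op α (R.op t x) =
      Complex.exp (-(Complex.I * α * t / ħ)) • R.op t (S.op α x)

/-- The generalized vector `χ` is, on the subspace `V`, a generalized eigenvector of the operator
`T` of `V` with the real eigenvalue `c`: it does not vanish, and `⟨T φ|χ⟩ = c ⟨φ|χ⟩`, for the test
vectors `φ` for which both sides make sense. -/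
def IsGeneralizedEigenvector {A : H →ₗ.[ℂ] H} {V : Submodule ℂ H} (T : V →ₗ.[ℂ] V)
    (χ : GeneralizedVector A) (c : ℝ) : Prop :=
  (∃ (φ Tφ : V) (_ : (φ, Tφ) ∈ T.graph) (hφ : (φ : H) ∈ A.domain)
    (_ : (Tφ : H) ∈ A.domain), χ.pair ⟨φ, hφ⟩ ≠ 0) ∧
  ∀ (φ Tφ : V) (_ : (φ, Tφ) ∈ T.graph) (hφ : (φ : H) ∈ A.domain) (hTφ : (Tφ : H) ∈ A.domain),
    χ.pair ⟨Tφ, hTφ⟩ = (c : ℂ) * χ.pair ⟨φ, hφ⟩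

end Operators

end TimeOp

end
/-
A primitive `F` of the history, `F t = ∫₀ᵗ ψ(s) ds`, is a cocycle: `F (s + t) = F s + U(s) (F t)`.
Distinguishability makes the symmetric second difference quotient of `t ↦ ‖F t‖²` tend to zero
away from the origin, so by Schwarz's theorem `‖F t‖²` is affine on each half-line. Polarization
then gives `⟪F s, F t⟫ = ‖F 1‖² (|s| + |t| - |s - t|) / 2`, up to a constant the Gram matrix of the
signed indicators of `[0, t]` in `L²(ℝ)`. Hence these correspond under a unitary map `W` of the
closed span of the history onto `L²(ℝ)`, which carries the evolution to the translations and so its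
Hamiltonian to the generator of the translations. The canonical pair of position and translations
is pulled back along `W`, and pairing `F` with a vector and differentiating identifies the
components of the vector with `⟨φ|ψ(τ)⟩`.
-/

noncomputable section

namespace TimeOp

section Basic

variable {𝕜 E F : Type*} [RCLike 𝕜] [NormedAddCommGroup E] [NormedAddCommGroup F]

/-- A set `S` of vectors is total if only the zero vector is orthogonal to it. For a family
`v : ι → E` this is used with `S = Set.range v`. -/
def IsTotal (𝕜 : Type*) [RCLike 𝕜] {E : Type*} [NormedAddCommGroup E] [InnerProductSpace 𝕜 E]
    (S : Set E) : Prop :=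
  ∀ w : E, (∀ φ ∈ S, ⟪φ, w⟫_𝕜 = 0) → w = 0

theorem isTotal_of_dense [InnerProductSpace 𝕜 E] {S : Set E} (hS : Dense S) : IsTotal 𝕜 S :=
  fun _ hw => hS.eq_zero_of_inner_right 𝕜 hw

theorem IsTotal.dense_span [InnerProductSpace 𝕜 E] [CompleteSpace E] {S : Set E}
    (hS : IsTotal 𝕜 S) : Dense (Submodule.span 𝕜 S : Set E) := by
  rw [Submodule.dense_iff_topologicalClosure_eq_top, Submodule.topologicalClosure_eq_top_iff,
    Submodule.eq_bot_iff]
  exact fun w hw => hS w fun φ hφ => hw φ (Submodule.subset_span hφ)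

theorem isTotal_range_of_le_topologicalClosure [InnerProductSpace 𝕜 E] {ι : Type*}
    {V : Submodule 𝕜 E} {v : ι → V}
    (hV : V ≤ (Submodule.span 𝕜 (Set.range fun i => (v i : E))).topologicalClosure) :
    IsTotal 𝕜 (Set.range v) := by
  intro w hw
  have hle : (Submodule.span 𝕜 (Set.range fun i => (v i : E))).topologicalClosure ≤
      (𝕜 ∙ (w : E))ᗮ :=
    Submodule.topologicalClosure_minimal _ (Submodule.span_le.2 (Set.range_subset_iff.2 fun i =>
      Submodule.mem_orthogonal_singleton_iff_inner_left.2 (hw _ ⟨i, rfl⟩)))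
      (Submodule.isClosed_orthogonal _)
  exact Subtype.ext (inner_self_eq_zero.1
    (Submodule.mem_orthogonal_singleton_iff_inner_left.1 (hle (hV w.2))))

theorem IsTotal.range_const_smul [InnerProductSpace 𝕜 E] {ι : Type*} {v : ι → E}
    (hv : IsTotal 𝕜 (Set.range v)) {c : 𝕜} (hc : c ≠ 0) :
    IsTotal 𝕜 (Set.range fun i => c • v i) := by
  refine fun w hw => hv w (Set.forall_mem_range.2 fun i => ?_)
  have hi := hw _ ⟨i, rfl⟩
  rw [inner_smul_left] at hi
  exact (mul_eq_zero.1 hi).resolve_left ((map_ne_zero _).2 hc)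

theorem hasDerivAt_clm_comp [NormedSpace ℂ E] [NormedSpace ℂ F] (T : E →L[ℂ] F) {f : ℝ → E}
    {z : E} {t : ℝ} (h : HasDerivAt f z t) : HasDerivAt (fun s => T (f s)) (T z) t :=
  (T.restrictScalars ℝ).hasFDerivAt.comp_hasDerivAt t h

theorem hasDerivAt_map_iff [NormedSpace ℂ E] [NormedSpace ℂ F] (W : E ≃ₗᵢ[ℂ] F) {f : ℝ → E}
    {z : E} {t : ℝ} : HasDerivAt (fun s => W (f s)) (W z) t ↔ HasDerivAt f z t := by
  refine ⟨fun h => ?_, hasDerivAt_clm_comp (W.toContinuousLinearEquiv : E →L[ℂ] F)⟩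
  simpa using hasDerivAt_clm_comp (W.symm.toContinuousLinearEquiv : F →L[ℂ] E) h

theorem hasDerivAt_inner_right [InnerProductSpace ℂ E] (φ : E) {f : ℝ → E} {z : E} {t : ℝ}
    (h : HasDerivAt f z t) : HasDerivAt (fun s => ⟪φ, f s⟫_ℂ) ⟪φ, z⟫_ℂ t :=
  hasDerivAt_clm_comp (innerSL ℂ φ) h

theorem conj_inv_I_mul (r : ℝ) :
    starRingEnd ℂ (Complex.I * r : ℂ)⁻¹ = -(Complex.I * r : ℂ)⁻¹ := by
  simp

end Basic

namespace UnitaryGroup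

variable {H : Type*} [NormedAddCommGroup H] [InnerProductSpace ℂ H] (U : UnitaryGroup H)

theorem op_zero (x : H) : U.op 0 x = x := by
  have h := U.op_add 0 0 x
  rw [add_zero] at h
  exact ((U.op 0).injective h).symm

theorem op_neg_op (t : ℝ) (x : H) : U.op (-t) (U.op t x) = x := by
  rw [← U.op_add, neg_add_cancel, U.op_zero]

theorem op_op_neg (t : ℝ) (x : H) : U.op t (U.op (-t) x) = x := by
  rw [← U.op_add, add_neg_cancel, U.op_zero]

theorem inner_op_left (t : ℝ) (x y : H) : ⟪U.op t x, y⟫_ℂ = ⟪x, U.op (-t) y⟫_ℂ := by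
  rw [← (U.op t).inner_map_map x, U.op_op_neg]

theorem inner_op_right (t : ℝ) (x y : H) : ⟪x, U.op t y⟫_ℂ = ⟪U.op (-t) x, y⟫_ℂ := by
  rw [U.inner_op_left, neg_neg]

theorem hasDerivAt_op {x z : H} (h : HasDerivAt (fun t => U.op t x) z 0) (t : ℝ) :
    HasDerivAt (fun s => U.op s x) (U.op t z) t := by
  have h0 : HasDerivAt (fun s => U.op s x) z (t - t) := by rwa [sub_self]
  simpa [← U.op_add] using ((hasDerivAt_map_iff (U.op t)).2 h0).comp_sub_const t t

theorem mem_graph_hamiltonian_of_hasDerivAt (ħ : ℝ) {x z : H}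
    (h : HasDerivAt (fun t => U.op t x) z 0) :
    (x, (Complex.I * ħ) • z) ∈ (U.hamiltonian ħ).graph :=
  (LinearPMap.mem_graph_iff _).2
    ⟨⟨x, h.differentiableAt⟩, rfl, congrArg ((Complex.I * ħ : ℂ) • ·) h.deriv⟩

theorem mem_graph_hamiltonian_op (ħ t : ℝ) {x y : H} (h : (x, y) ∈ (U.hamiltonian ħ).graph) :
    (U.op t x, U.op t y) ∈ (U.hamiltonian ħ).graph := by
  obtain ⟨x', rfl, rfl⟩ := (LinearPMap.mem_graph_iff _).1 h
  exact (LinearPMap.mem_graph_iff _).2 ⟨_, rfl, U.hamiltonian_op ħ t x'⟩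

variable {ħ : ℝ}

theorem mem_graph_hamiltonian (hħ : ħ ≠ 0) {x y : H} :
    (x, y) ∈ (U.hamiltonian ħ).graph ↔
      HasDerivAt (fun t => U.op t x) ((Complex.I * ħ)⁻¹ • y) 0 := by
  have hc : (Complex.I * ħ : ℂ) ≠ 0 := by simp [hħ]
  refine ⟨fun h => ?_, fun h => ?_⟩
  · obtain ⟨⟨x', hx⟩, rfl, rfl⟩ := (LinearPMap.mem_graph_iff _).1 h
    change HasDerivAt _ ((Complex.I * ħ)⁻¹ • (Complex.I * ħ : ℂ) • deriv (fun t => U.op t x') 0) 0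
    rw [inv_smul_smul₀ hc]
    exact DifferentiableAt.hasDerivAt hx
  · simpa only [smul_inv_smul₀ hc] using U.mem_graph_hamiltonian_of_hasDerivAt ħ h

theorem hasDerivAt_inner_op (hħ : ħ ≠ 0) {x y : H} (h : (x, y) ∈ (U.hamiltonian ħ).graph)
    (φ : H) (t : ℝ) :
    HasDerivAt (fun s => ⟪φ, U.op s x⟫_ℂ) ((Complex.I * ħ)⁻¹ * ⟪φ, U.op t y⟫_ℂ) t := by
  simpa only [map_smul, inner_smul_right] using
    hasDerivAt_inner_right φ (U.hasDerivAt_op ((U.mem_graph_hamiltonian hħ).1 h) t)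

theorem inner_hamiltonian_symm (hħ : ħ ≠ 0) {x y x' y' : H}
    (h : (x, y) ∈ (U.hamiltonian ħ).graph) (h' : (x', y') ∈ (U.hamiltonian ħ).graph) :
    ⟪y, x'⟫_ℂ = ⟪x, y'⟫_ℂ := by
  have hderiv := ((U.mem_graph_hamiltonian hħ).1 h).inner ℂ ((U.mem_graph_hamiltonian hħ).1 h')
  simp only [(U.op _).inner_map_map, U.op_zero] at hderiv
  have hzero := hderiv.unique (hasDerivAt_const _ _)
  rw [inner_smul_left, inner_smul_right, conj_inv_I_mul] at hzero
  have hc : (Complex.I * ħ : ℂ)⁻¹ ≠ 0 := by simp [hħ]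
  refine mul_left_cancel₀ hc ?_
  linear_combination -hzero

variable [CompleteSpace H]

theorem hasDerivAt_integral_op (x : H) (t : ℝ) :
    HasDerivAt (fun t => ∫ s in (0 : ℝ)..t, U.op s x) (U.op t x) t :=
  (U.continuous_op x).integral_hasStrictDerivAt 0 t |>.hasDerivAt

theorem op_integral_op (x : H) (r t : ℝ) :
    U.op t (∫ s in (0 : ℝ)..r, U.op s x) =
      (∫ s in (0 : ℝ)..(r + t), U.op s x) - ∫ s in (0 : ℝ)..t, U.op s x := by
  have hi (a b : ℝ) : IntervalIntegrable (fun s => U.op s x) volume a b :=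
    (U.continuous_op x).intervalIntegrable a b
  calc U.op t (∫ s in (0 : ℝ)..r, U.op s x) = ∫ s in (0 : ℝ)..r, U.op t (U.op s x) :=
        ((U.op t).toContinuousLinearEquiv.toContinuousLinearMap.intervalIntegral_comp_comm
          (hi 0 r)).symm
    _ = ∫ s in (0 : ℝ)..r, U.op (s + t) x := by simp only [← U.op_add, add_comm]
    _ = ∫ s in (0 + t)..(r + t), U.op s x :=
        intervalIntegral.integral_comp_add_right (fun s => U.op s x) t
    _ = _ := by rw [zero_add, intervalIntegral.integral_interval_sub_left (hi _ _) (hi _ _)]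

theorem mem_graph_integral_op (ħ : ℝ) (x : H) (r : ℝ) :
    (∫ s in (0 : ℝ)..r, U.op s x, (Complex.I * ħ) • (U.op r x - x)) ∈
      (U.hamiltonian ħ).graph := by
  refine U.mem_graph_hamiltonian_of_hasDerivAt ħ ?_
  simp only [U.op_integral_op]
  have hr : HasDerivAt (fun t => ∫ s in (0 : ℝ)..(r + t), U.op s x) (U.op r x) 0 := by
    simpa only [add_zero] using (U.hasDerivAt_integral_op x (r + 0)).comp_const_add r 0
  simpa only [U.op_zero] using hr.fun_sub (U.hasDerivAt_integral_op x 0)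

theorem dense_domain (ħ : ℝ) : Dense ((U.hamiltonian ħ).domain : Set H) := by
  intro x
  have h := (U.hasDerivAt_integral_op x 0).tendsto_slope_zero_right
  rw [U.op_zero] at h
  refine mem_closure_of_tendsto h (Eventually.of_forall fun t => ?_)
  simp only [zero_add, intervalIntegral.integral_same, sub_zero]
  exact (U.hamiltonian ħ).domain.smul_of_tower_mem t⁻¹
    (LinearPMap.mem_domain_of_mem_graph (U.mem_graph_integral_op ħ x t))

theorem hasDerivAt_op_of_isTotal {S : Set H} (hS : IsTotal ℂ S) {x z : H}
    (h : ∀ φ ∈ S, ∀ t : ℝ, HasDerivAt (fun s => ⟪φ, U.op s x⟫_ℂ) ⟪φ, U.op t z⟫_ℂ t) :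
    HasDerivAt (fun t => U.op t x) z 0 := by
  have key (t : ℝ) : U.op t x = x + ∫ s in (0 : ℝ)..t, U.op s z := by
    refine sub_eq_zero.1 (hS _ fun φ hφ => ?_)
    have hderiv (r : ℝ) : HasDerivAt
        (fun r => ⟪φ, U.op r x⟫_ℂ - (⟪φ, x⟫_ℂ + ⟪φ, ∫ s in (0 : ℝ)..r, U.op s z⟫_ℂ)) 0 r := by
      simpa only [sub_self] using (h φ hφ r).fun_sub
        ((hasDerivAt_inner_right φ (U.hasDerivAt_integral_op z r)).const_add ⟪φ, x⟫_ℂ)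
    have hconst := is_const_of_deriv_eq_zero (fun r => (hderiv r).differentiableAt)
      (fun r => (hderiv r).deriv) t 0
    simpa [inner_sub_right, inner_add_right, U.op_zero] using hconst
  have hderiv := (U.hasDerivAt_integral_op z 0).const_add x
  rw [U.op_zero] at hderiv
  exact hderiv.congr_of_eventuallyEq (Eventually.of_forall key)

theorem mem_graph_hamiltonian_iff_of_isTotal (hħ : ħ ≠ 0) {S : Set H} (hS : IsTotal ℂ S)
    {x y : H} :
    (x, y) ∈ (U.hamiltonian ħ).graph ↔ ∀ φ ∈ S, ∀ t : ℝ,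
      HasDerivAt (fun s => ⟪φ, U.op s x⟫_ℂ) ((Complex.I * ħ)⁻¹ * ⟪φ, U.op t y⟫_ℂ) t := by
  refine ⟨fun h φ _ t => U.hasDerivAt_inner_op hħ h φ t, fun h => ?_⟩
  refine (U.mem_graph_hamiltonian hħ).2 (U.hasDerivAt_op_of_isTotal hS fun φ hφ t => ?_)
  simpa only [map_smul, inner_smul_right] using h φ hφ t

theorem isSelfAdjoint_hamiltonian (hħ : ħ ≠ 0) : IsSelfAdjoint (U.hamiltonian ħ) := by
  rw [LinearPMap.isSelfAdjoint_def]
  apply LinearPMap.eq_of_eq_graph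
  rw [LinearPMap.adjoint_graph_eq_graph_adjoint (U.dense_domain ħ)]
  ext ⟨x, y⟩
  rw [Submodule.mem_adjoint_iff]
  refine ⟨fun h => ?_, fun h a b hab => sub_eq_zero.2 (U.inner_hamiltonian_symm hħ hab h)⟩
  rw [U.mem_graph_hamiltonian_iff_of_isTotal hħ (isTotal_of_dense (U.dense_domain ħ))]
  intro φ hφ t
  have hgraph (s : ℝ) := U.mem_graph_hamiltonian_op ħ s ((U.hamiltonian ħ).mem_graph ⟨φ, hφ⟩)
  have hadj : ⟪U.op (-t) (U.hamiltonian ħ ⟨φ, hφ⟩), x⟫_ℂ = ⟪U.op (-t) φ, y⟫_ℂ :=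
    sub_eq_zero.1 (h _ _ (hgraph (-t)))
  have horbit : HasDerivAt (fun s => U.op (-s) φ)
      (-U.op (-t) ((Complex.I * ħ)⁻¹ • U.hamiltonian ħ ⟨φ, hφ⟩)) t := by
    have := U.hasDerivAt_op ((U.mem_graph_hamiltonian hħ).1 ((U.hamiltonian ħ).mem_graph ⟨φ, hφ⟩))
      (-t)
    simpa using! this.scomp t (hasDerivAt_neg t)
  have hderiv := horbit.inner ℂ (hasDerivAt_const t x)
  rw [inner_zero_right, zero_add] at hderiv
  simp only [← U.inner_op_right] at hderiv
  refine hderiv.congr_deriv ?_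
  rw [map_smul, inner_neg_left, inner_smul_left, conj_inv_I_mul, hadj, U.inner_op_right]
  ring

end UnitaryGroup

section Transport

variable {K L : Type*} [NormedAddCommGroup K] [InnerProductSpace ℂ K]
  [NormedAddCommGroup L] [InnerProductSpace ℂ L]

namespace Represents

variable {W : K ≃ₗᵢ[ℂ] L} {A A' : K →ₗ.[ℂ] K} {B : L →ₗ.[ℂ] L}

theorem eq_left (h : Represents W A B) (h' : Represents W A' B) : A = A' := by
  apply LinearPMap.eq_of_eq_graph
  ext ⟨x, y⟩
  exact (h x y).trans (h' x y).symm

theorem symm_mem_graph (h : Represents W A B) {f g : L} (hfg : (f, g) ∈ B.graph) :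
    (W.symm f, W.symm g) ∈ A.graph :=
  (h _ _).2 (by simpa only [W.apply_symm_apply] using hfg)

end Represents

/-- The operator `W⁻¹ B W` of `K` that a unitary map `W : K → L` carries to the operator `B` of
`L`. -/
def pullbackOperator (W : K ≃ₗᵢ[ℂ] L) (B : L →ₗ.[ℂ] L) : K →ₗ.[ℂ] K :=
  (B.graph.comap (W.toLinearEquiv.toLinearMap.prodMap W.toLinearEquiv.toLinearMap)).toLinearPMap

theorem represents_pullbackOperator (W : K ≃ₗᵢ[ℂ] L) (B : L →ₗ.[ℂ] L) :
    Represents W (pullbackOperator W B) B := by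
  intro x y
  unfold pullbackOperator
  rw [Submodule.toLinearPMap_graph_eq]
  · simp
  · rintro ⟨u, v⟩ h (rfl : u = 0)
    exact W.map_eq_zero_iff.1 (B.graph_fst_eq_zero_snd (by simpa using h) rfl)

namespace UnitaryGroup

/-- The unitary group of `K` that a unitary map `W : K → L` carries to the group `U` of `L`. -/
def pullback (W : K ≃ₗᵢ[ℂ] L) (U : UnitaryGroup L) : UnitaryGroup K where
  op t := (W.trans (U.op t)).trans W.symm
  op_add s t x := by simp [U.op_add]
  continuous_op x := W.symm.continuous.comp (U.continuous_op (W x))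

theorem map_pullback_op (W : K ≃ₗᵢ[ℂ] L) (U : UnitaryGroup L) (t : ℝ) (x : K) :
    W ((U.pullback W).op t x) = U.op t (W x) :=
  W.apply_symm_apply _

theorem represents_hamiltonian {ħ : ℝ} (hħ : ħ ≠ 0) {U : UnitaryGroup K} {U' : UnitaryGroup L}
    {W : K ≃ₗᵢ[ℂ] L} (h : ∀ t x, W (U.op t x) = U'.op t (W x)) :
    Represents W (U.hamiltonian ħ) (U'.hamiltonian ħ) := by
  intro x y
  rw [mem_graph_hamiltonian _ hħ, mem_graph_hamiltonian _ hħ, ← hasDerivAt_map_iff W]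
  simp only [h, map_smul]

variable {V : Submodule ℂ K}

/-- The restriction of a unitary group to an invariant subspace. -/
def restrict (U : UnitaryGroup K) (hV : ∀ t, ∀ x ∈ V, U.op t x ∈ V) : UnitaryGroup V where
  op t :=
    { toFun := fun x => ⟨U.op t x, hV t x x.2⟩
      map_add' := fun x y => by ext; simp
      map_smul' := fun c x => by ext; simp
      invFun := fun x => ⟨U.op (-t) x, hV (-t) x x.2⟩
      left_inv := fun x => by ext; simp [U.op_neg_op]
      right_inv := fun x => by ext; simp [U.op_op_neg]
      norm_map' := fun x => (U.op t).norm_map x }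
  op_add s t x := by ext; exact U.op_add s t x
  continuous_op x := (U.continuous_op x).subtype_mk _

theorem hamiltonian_restrict {ħ : ℝ} (hħ : ħ ≠ 0) (U : UnitaryGroup K)
    (hV : ∀ t, ∀ x ∈ V, U.op t x ∈ V) :
    (U.restrict hV).hamiltonian ħ = restrictTo (U.hamiltonian ħ) V := by
  apply LinearPMap.eq_of_eq_graph
  ext ⟨x, y⟩
  rw [mem_graph_restrictTo, mem_graph_hamiltonian _ hħ, mem_graph_hamiltonian _ hħ]
  simp only [hasDerivAt_iff_tendsto_slope_zero]
  rw [tendsto_subtype_rng]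
  rfl

theorem hamiltonian_mem_of_isClosed (ħ : ℝ) (U : UnitaryGroup K)
    (hV : ∀ t, ∀ x ∈ V, U.op t x ∈ V) (hc : IsClosed (V : Set K))
    (x : (U.hamiltonian ħ).domain) (hx : (x : K) ∈ V) : U.hamiltonian ħ x ∈ V := by
  have hderiv : HasDerivAt (fun t => U.op t (x : K)) (deriv (fun t => U.op t (x : K)) 0) 0 :=
    DifferentiableAt.hasDerivAt x.2
  refine V.smul_mem _ (hc.mem_of_tendsto hderiv.tendsto_slope_zero_right
    (Eventually.of_forall fun t => ?_))
  exact V.smul_of_tower_mem _ (V.sub_mem (hV _ _ hx) (hV _ _ hx))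

end UnitaryGroup

end Transport

section Weyl

variable {K L : Type*} [NormedAddCommGroup K] [InnerProductSpace ℂ K]
  [NormedAddCommGroup L] [InnerProductSpace ℂ L]

/-- The Weyl relations between `S α = exp (-i α T / ħ)` and `R t = exp (-i t A / ħ)`. -/
def WeylRelations (ħ : ℝ) (S R : UnitaryGroup K) : Prop :=
  ∀ (α t : ℝ) (x : K),
    S.op α (R.op t x) = Complex.exp (-(Complex.I * α * t / ħ)) • R.op t (S.op α x)

/-- The domain `D(TA) ∩ D(AT)` of the commutator `[T, A]`. -/
def commutatorDomain (T A : K →ₗ.[ℂ] K) : Set K :=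
  {x | ∃ Tx Ax TAx ATx : K, (x, Tx) ∈ T.graph ∧ (x, Ax) ∈ A.graph ∧
    (Ax, TAx) ∈ T.graph ∧ (Tx, ATx) ∈ A.graph}

variable {ħ : ℝ} {S R : UnitaryGroup K}

theorem op_mem_graph_of_weyl (hħ : ħ ≠ 0) (hweyl : WeylRelations ħ S R)
    {x Ax : K} (hA : (x, Ax) ∈ (R.hamiltonian ħ).graph) (α : ℝ) :
    (S.op α x, S.op α Ax - (α : ℂ) • S.op α x) ∈ (R.hamiltonian ħ).graph := by
  have hflow (t : ℝ) : R.op t (S.op α x) =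
      Complex.exp (t * (Complex.I * α / ħ)) • S.op α (R.op t x) := by
    rw [hweyl, smul_smul, ← Complex.exp_add, mul_div_assoc', mul_comm (t : ℂ), add_neg_cancel,
      Complex.exp_zero, one_smul]
  have hexp : HasDerivAt (fun t : ℝ => Complex.exp (t * (Complex.I * α / ħ)))
      (Complex.I * α / ħ) 0 := by
    simpa using ((Complex.ofRealCLM.hasDerivAt (x := 0)).mul_const (Complex.I * α / ħ)).cexp
  have hderiv := hexp.fun_smul
    ((hasDerivAt_map_iff (S.op α)).2 ((R.mem_graph_hamiltonian hħ).1 hA))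
  simp only [← hflow] at hderiv
  rw [R.mem_graph_hamiltonian hħ]
  refine hderiv.congr_deriv ?_
  simp only [Complex.ofReal_zero, zero_mul, one_mul, Complex.exp_zero, R.op_zero, map_smul,
    smul_sub, smul_smul]
  rw [sub_eq_add_neg, ← neg_smul]
  congr 2
  rw [mul_inv, Complex.inv_I]
  ring

variable [CompleteSpace K] [CompleteSpace L]

theorem commutator_of_weyl (hħ : ħ ≠ 0) (hweyl : WeylRelations ħ S R)
    {x Tx Ax TAx ATx : K} (hT : (x, Tx) ∈ (S.hamiltonian ħ).graph)
    (hA : (x, Ax) ∈ (R.hamiltonian ħ).graph) (hTA : (Ax, TAx) ∈ (S.hamiltonian ħ).graph)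
    (hAT : (Tx, ATx) ∈ (R.hamiltonian ħ).graph) :
    TAx - ATx = (Complex.I * ħ) • x := by
  have hc : (Complex.I * ħ : ℂ) ≠ 0 := by simp [hħ]
  refine (R.dense_domain ħ).eq_of_inner_right ℂ fun y hy => ?_
  obtain ⟨Ay, hAy⟩ : ∃ Ay, (y, Ay) ∈ (R.hamiltonian ħ).graph :=
    ⟨_, (R.hamiltonian ħ).mem_graph ⟨y, hy⟩⟩
  have hshift (α : ℝ) : ⟪Ay, S.op α x⟫_ℂ = ⟪y, S.op α Ax⟫_ℂ - α * ⟪y, S.op α x⟫_ℂ := by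
    rw [R.inner_hamiltonian_symm hħ hAy (op_mem_graph_of_weyl hħ hweyl hA α), inner_sub_right,
      inner_smul_right]
  have hleft := S.hasDerivAt_inner_op hħ hT Ay 0
  have hright := (S.hasDerivAt_inner_op hħ hTA y 0).fun_sub
    ((Complex.ofRealCLM.hasDerivAt (x := 0)).fun_mul (S.hasDerivAt_inner_op hħ hT y 0))
  simp only [hshift] at hleft
  have hderiv := hleft.unique hright
  simp only [S.op_zero, Complex.ofRealCLM_apply, Complex.ofReal_one, Complex.ofReal_zero, one_mul,
    zero_mul, add_zero, R.inner_hamiltonian_symm hħ hAy hAT] at hderiv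
  rw [inner_sub_right, inner_smul_right]
  have hmul := congrArg ((Complex.I * ħ : ℂ) * ·) hderiv
  simp only [mul_sub, mul_inv_cancel_left₀ hc] at hmul
  linear_combination -hmul

theorem isCanonicalConjugate_of_weyl (hħ : ħ ≠ 0) (hweyl : WeylRelations ħ S R)
    (hdense : Dense (commutatorDomain (S.hamiltonian ħ) (R.hamiltonian ħ))) :
    IsCanonicalConjugate ħ (S.hamiltonian ħ) (R.hamiltonian ħ) where
  selfAdjoint_left := S.isSelfAdjoint_hamiltonian hħ
  selfAdjoint_right := R.isSelfAdjoint_hamiltonian hħ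
  dense_commutator := hdense
  commutator _ _ _ _ _ := commutator_of_weyl hħ hweyl
  weyl := ⟨S, R, rfl, rfl, hweyl⟩

theorem IsCanonicalConjugate.of_represents (hħ : ħ ≠ 0) {W : K ≃ₗᵢ[ℂ] L} {T A : K →ₗ.[ℂ] K}
    {T' A' : L →ₗ.[ℂ] L} (h : IsCanonicalConjugate ħ T' A') (hT : Represents W T T')
    (hA : Represents W A A') : IsCanonicalConjugate ħ T A := by
  obtain ⟨S, R, rfl, rfl, hweyl⟩ := h.weyl
  obtain rfl := hT.eq_left (UnitaryGroup.represents_hamiltonian hħ (S.map_pullback_op W))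
  obtain rfl := hA.eq_left (UnitaryGroup.represents_hamiltonian hħ (R.map_pullback_op W))
  refine isCanonicalConjugate_of_weyl hħ (fun α t x => W.injective ?_) ?_
  · simp only [UnitaryGroup.map_pullback_op, map_smul, hweyl]
  · refine (W.symm.surjective.denseRange.dense_image W.symm.continuous h.dense_commutator).mono ?_
    rintro _ ⟨f, ⟨Tf, Af, TAf, ATf, h₁, h₂, h₃, h₄⟩, rfl⟩
    exact ⟨_, _, _, _, hT.symm_mem_graph h₁, hA.symm_mem_graph h₂, hT.symm_mem_graph h₃,
      hA.symm_mem_graph h₄⟩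

end Weyl

section Schwarz

variable {E F : Type*} [NormedAddCommGroup E] [NormedSpace ℝ E] [NormedAddCommGroup F]
  [NormedSpace ℝ F]

/-- `f` has the symmetric (Schwarz) second derivative `c` at `x`: the limit of
`(f (x + ε) + f (x - ε) - 2 f x) / ε²` as `ε → 0+`, which exists and agrees with `f'' x` where `f`
is twice differentiable. -/
def HasSymmSecondDerivAt (f : ℝ → E) (c : E) (x : ℝ) : Prop :=
  Tendsto (fun ε : ℝ => (ε ^ 2)⁻¹ • (f (x + ε) + f (x - ε) - (2 : ℝ) • f x)) (𝓝[>] 0) (𝓝 c)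

namespace HasSymmSecondDerivAt

variable {f g : ℝ → E} {c d : E} {x : ℝ}

theorem clm_comp (T : E →L[ℝ] F) (hf : HasSymmSecondDerivAt f c x) :
    HasSymmSecondDerivAt (fun y => T (f y)) (T c) x := by
  simpa only [HasSymmSecondDerivAt, Function.comp_def, map_smul, map_sub, map_add] using
    (T.continuous.tendsto c).comp hf

theorem sub (hf : HasSymmSecondDerivAt f c x) (hg : HasSymmSecondDerivAt g d x) :
    HasSymmSecondDerivAt (fun y => f y - g y) (c - d) x := by
  refine (Tendsto.sub hf hg).congr fun ε => ?_
  rw [← smul_sub]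
  congr 1
  module

theorem congr_of_forall (hf : HasSymmSecondDerivAt f c x) (h : ∀ ε > 0,
    f (x + ε) + f (x - ε) - (2 : ℝ) • f x = g (x + ε) + g (x - ε) - (2 : ℝ) • g x) :
    HasSymmSecondDerivAt g c x :=
  Tendsto.congr' (eventually_mem_nhdsWithin.mono fun ε hε => by rw [h ε hε]) hf

end HasSymmSecondDerivAt

theorem hasSymmSecondDerivAt_quadratic (a b x : ℝ) :
    HasSymmSecondDerivAt (fun y : ℝ => (y - a) * (b - y)) (-2) x := by
  refine tendsto_const_nhds.congr' (eventually_mem_nhdsWithin.mono fun ε hε => ?_)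
  have hε' : ε ≠ 0 := ne_of_gt hε
  simp only [smul_eq_mul]
  field_simp
  ring

theorem HasSymmSecondDerivAt.nonpos_of_isLocalMax {f : ℝ → ℝ} {c x : ℝ}
    (hf : HasSymmSecondDerivAt f c x) (hmax : IsLocalMax f x) : c ≤ 0 := by
  have hright : ∀ᶠ ε in 𝓝[>] (0 : ℝ), f (x + ε) ≤ f x :=
    (Continuous.tendsto' (by fun_prop) 0 x (add_zero x)).eventually hmax |>.filter_mono
      nhdsWithin_le_nhds
  have hleft : ∀ᶠ ε in 𝓝[>] (0 : ℝ), f (x - ε) ≤ f x :=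
    (Continuous.tendsto' (by fun_prop) 0 x (sub_zero x)).eventually hmax |>.filter_mono
      nhdsWithin_le_nhds
  refine le_of_tendsto hf ?_
  filter_upwards [hright, hleft] with ε h₁ h₂
  refine mul_nonpos_of_nonneg_of_nonpos (by positivity) ?_
  simp only [smul_eq_mul]
  linarith

variable {a b x : ℝ}

theorem nonpos_of_hasSymmSecondDerivAt {f : ℝ → ℝ} (hf : ContinuousOn f (Set.Icc a b))
    (h : ∀ x ∈ Set.Ioo a b, HasSymmSecondDerivAt f 0 x) (ha : f a = 0) (hb : f b = 0)
    (hx : x ∈ Set.Icc a b) : f x ≤ 0 := by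
  -- Subtracting `δ (y - a) (b - y)` makes the second derivative positive, which excludes an
  -- interior maximum.
  have key (δ : ℝ) (hδ : 0 < δ) : f x - δ * ((x - a) * (b - x)) ≤ 0 := by
    set g : ℝ → ℝ := fun y => f y - δ * ((y - a) * (b - y)) with hg
    obtain ⟨y, hy, hmax⟩ := isCompact_Icc.exists_isMaxOn ⟨x, hx⟩
      (show ContinuousOn g (Set.Icc a b) from hf.sub (by fun_prop))
    suffices hend : y = a ∨ y = b by
      refine (hmax hx).trans (le_of_eq ?_)
      rcases hend with rfl | rfl <;> simp [hg, ha, hb]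
    by_contra! hne
    have hy' : y ∈ Set.Ioo a b := ⟨hy.1.lt_of_ne hne.1.symm, hy.2.lt_of_ne hne.2⟩
    have hderiv := (h y hy').sub ((hasSymmSecondDerivAt_quadratic a b y).clm_comp
      (ContinuousLinearMap.lsmul ℝ ℝ δ))
    have hle := hderiv.nonpos_of_isLocalMax (hmax.isLocalMax (Icc_mem_nhds hy'.1 hy'.2))
    simp only [ContinuousLinearMap.lsmul_apply, smul_eq_mul] at hle
    linarith
  have hlim : Tendsto (fun δ : ℝ => f x - δ * ((x - a) * (b - x))) (𝓝[>] 0) (𝓝 (f x)) :=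
    (Continuous.tendsto' (by fun_prop) 0 _ (by simp)).mono_left nhdsWithin_le_nhds
  exact le_of_tendsto hlim (eventually_mem_nhdsWithin.mono key)

theorem affine_of_hasSymmSecondDerivAt {f : ℝ → E} (hf : ContinuousOn f (Set.Icc a b))
    (h : ∀ x ∈ Set.Ioo a b, HasSymmSecondDerivAt f 0 x) (hx : x ∈ Set.Icc a b) :
    (b - a) • f x = (b - x) • f a + (x - a) • f b := by
  set g : ℝ → E := fun y => (b - a) • f y - ((b - y) • f a + (y - a) • f b) with hg
  have hgc : ContinuousOn g (Set.Icc a b) := (hf.const_smul (b - a)).sub (by fun_prop)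
  have hderiv (y : ℝ) (hy : y ∈ Set.Ioo a b) : HasSymmSecondDerivAt g 0 y := by
    have hscaled := (h y hy).clm_comp ((b - a) • ContinuousLinearMap.id ℝ E)
    rw [map_zero] at hscaled
    refine hscaled.congr_of_forall fun ε _ => ?_
    simp only [hg, _root_.smul_apply, ContinuousLinearMap.id_apply]
    module
  have hnonpos (ℓ : StrongDual ℝ E) : ℓ (g x) ≤ 0 := by
    refine nonpos_of_hasSymmSecondDerivAt (f := fun y => ℓ (g y))
      (ℓ.continuous.comp_continuousOn hgc) (fun y hy => ?_) ?_ ?_ hx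
    · simpa only [map_zero] using (hderiv y hy).clm_comp ℓ
    · simp [hg]
    · simp [hg]
  refine sub_eq_zero.1 (SeparatingDual.eq_zero_of_forall_dual_eq_zero (R := ℝ) fun ℓ => ?_)
  exact le_antisymm (hnonpos ℓ) (by simpa [hg] using hnonpos (-ℓ))

theorem eq_smul_of_hasSymmSecondDerivAt {f : ℝ → E} (hf : ContinuousOn f (Set.Ici 0))
    (h : ∀ x > 0, HasSymmSecondDerivAt f 0 x) (h0 : f 0 = 0) (hx : 0 ≤ x) : f x = x • f 1 := by
  have key {x b : ℝ} (hx : 0 ≤ x) (hxb : x ≤ b) : b • f x = x • f b := by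
    simpa [h0] using affine_of_hasSymmSecondDerivAt (hf.mono Set.Icc_subset_Ici_self)
      (fun y hy => h y hy.1) (⟨hx, hxb⟩ : x ∈ Set.Icc 0 b)
  rcases le_total x 1 with hx1 | hx1
  · simpa using key hx hx1
  · simpa using (key zero_le_one hx1).symm

end Schwarz

section Cocycles

variable {H : Type*} [NormedAddCommGroup H] [InnerProductSpace ℂ H]

/-- A curve `F` with `F (s + t) = F s + U s (F t)`, like `F t = ∫_0^t U r x dr` for a possibly
generalized vector `x`. -/
def UnitaryGroup.IsCocycle (U : UnitaryGroup H) (F : ℝ → H) : Prop :=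
  ∀ s t, F (s + t) = F s + U.op s (F t)

/-- The orthogonality of the generalized vectors `x` and `U t x` for all `t > 0`, in terms of the
cocycle `F t = ∫_0^t U r x dr`. -/
def UnitaryGroup.DeltaCorrelated (U : UnitaryGroup H) (F : ℝ → H) : Prop :=
  ∀ t > 0, Tendsto (fun ε : ℝ => (ε ^ 2)⁻¹ • ⟪F ε, U.op t (F ε)⟫_ℂ) (𝓝[>] 0) (𝓝 0)

namespace UnitaryGroup.IsCocycle

variable {U : UnitaryGroup H} {F : ℝ → H}

theorem zero (hF : U.IsCocycle F) : F 0 = 0 := by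
  simpa [U.op_zero] using hF 0 0

theorem const_smul (hF : U.IsCocycle F) (c : ℂ) : U.IsCocycle fun t => c • F t := by
  intro s t
  simp only [hF s t, smul_add, map_smul]

theorem op_apply (hF : U.IsCocycle F) (s t : ℝ) : U.op s (F t) = F (s + t) - F s := by
  rw [hF, add_sub_cancel_left]

theorem op_neg_self (hF : U.IsCocycle F) (s : ℝ) : U.op (-s) (F s) = -F (-s) := by
  rw [hF.op_apply, neg_add_cancel, hF.zero, zero_sub]

theorem norm_neg (hF : U.IsCocycle F) (s : ℝ) : ‖F (-s)‖ = ‖F s‖ := by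
  rw [← _root_.norm_neg, ← hF.op_neg_self, LinearIsometryEquiv.norm_map]

theorem op_sub (hF : U.IsCocycle F) (x ε : ℝ) : U.op (x - ε) (F ε) = F x - F (x - ε) := by
  rw [hF.op_apply, sub_add_cancel]

theorem second_difference (hF : U.IsCocycle F) (x ε : ℝ) :
    F (x + ε) + F (x - ε) - (2 : ℝ) • F x = U.op x (F ε) - U.op (x - ε) (F ε) := by
  rw [hF.op_apply, hF.op_sub, two_smul]
  abel

theorem inner_second_difference (hF : U.IsCocycle F) (x y ε : ℝ) :
    ⟪F y, F (x + ε) + F (x - ε) - (2 : ℝ) • F x⟫_ℂ =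
      ⟪F ε, U.op x (F ε)⟫_ℂ - ⟪F ε, U.op (x - y) (F ε)⟫_ℂ := by
  have hswap : F y - U.op ε (F y) = F ε - U.op y (F ε) := by
    rw [hF.op_apply, hF.op_apply, add_comm y ε]
    abel
  calc ⟪F y, F (x + ε) + F (x - ε) - (2 : ℝ) • F x⟫_ℂ
      = ⟪F y - U.op ε (F y), U.op x (F ε)⟫_ℂ := by
        rw [hF.second_difference, inner_sub_right, inner_sub_left, U.inner_op_left, ← U.op_add,
          neg_add_eq_sub]
    _ = ⟪F ε, U.op x (F ε)⟫_ℂ - ⟪F ε, U.op (x - y) (F ε)⟫_ℂ := by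
        rw [hswap, inner_sub_left, U.inner_op_left y, ← U.op_add, neg_add_eq_sub]

theorem norm_sq_second_difference (hF : U.IsCocycle F) (x ε : ℝ) :
    ‖F (x + ε)‖ ^ 2 + ‖F (x - ε)‖ ^ 2 - 2 * ‖F x‖ ^ 2 = 2 * (⟪F ε, U.op x (F ε)⟫_ℂ).re := by
  have hplus : ‖F (x + ε)‖ ^ 2 =
      ‖F x‖ ^ 2 + 2 * (⟪F x, U.op x (F ε)⟫_ℂ).re + ‖F ε‖ ^ 2 := by
    rw [hF x ε, norm_add_sq (𝕜 := ℂ), LinearIsometryEquiv.norm_map]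
    rfl
  have hminus : ‖F (x - ε)‖ ^ 2 =
      ‖F x‖ ^ 2 - 2 * (⟪F x, U.op (x - ε) (F ε)⟫_ℂ).re + ‖F ε‖ ^ 2 := by
    rw [← sub_sub_cancel (F x) (F (x - ε)), ← hF.op_sub, norm_sub_sq (𝕜 := ℂ),
      LinearIsometryEquiv.norm_map]
    rfl
  have hinner := congrArg Complex.re (hF.inner_second_difference x x ε)
  rw [hF.second_difference, inner_sub_right, sub_self, U.op_zero, Complex.sub_re, Complex.sub_re,
    ← RCLike.re_eq_complex_re, inner_self_eq_norm_sq, RCLike.re_eq_complex_re] at hinner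
  linarith

variable (hF : U.IsCocycle F) (hcont : Continuous F) (hδ : U.DeltaCorrelated F)
include hF hcont hδ

theorem norm_sq_eq (t : ℝ) : ‖F t‖ ^ 2 = |t| * ‖F 1‖ ^ 2 := by
  have hderiv (x : ℝ) (hx : 0 < x) : HasSymmSecondDerivAt (fun t => ‖F t‖ ^ 2) 0 x := by
    have hre := ((Complex.continuous_re.tendsto 0).comp (hδ x hx)).const_mul 2
    simp only [Complex.zero_re, mul_zero] at hre
    refine hre.congr fun ε => ?_
    simp only [Function.comp_apply, Complex.smul_re, smul_eq_mul, hF.norm_sq_second_difference]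
    ring
  have hpos {t : ℝ} (ht : 0 ≤ t) : ‖F t‖ ^ 2 = t * ‖F 1‖ ^ 2 :=
    eq_smul_of_hasSymmSecondDerivAt (f := fun t => ‖F t‖ ^ 2) (hcont.norm.pow 2).continuousOn
      hderiv (by simp [hF.zero]) ht
  rcases abs_cases t with ⟨h, ht⟩ | ⟨h, ht⟩
  · rw [h, hpos ht]
  · rw [h, ← hF.norm_neg, hpos (by linarith)]

theorem inner_eq_zero {s t : ℝ} (hs : s ≤ 0) (ht : 0 ≤ t) : ⟪F s, F t⟫_ℂ = 0 := by
  have hlinear {t : ℝ} (ht : 0 ≤ t) : ⟪F s, F t⟫_ℂ = t • ⟪F s, F 1⟫_ℂ := by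
    refine eq_smul_of_hasSymmSecondDerivAt (f := fun t => ⟪F s, F t⟫_ℂ)
      (continuous_const.inner hcont).continuousOn (fun x hx => ?_) (by simp [hF.zero]) ht
    have hlim := (hδ x hx).sub (hδ (x - s) (by linarith))
    rw [sub_zero] at hlim
    refine hlim.congr fun ε => ?_
    rw [← smul_sub, ← hF.inner_second_difference, inner_sub_right, inner_add_right,
      inner_smul_right_eq_smul]
  -- A linear function of `t` that is `O(√t)` vanishes.
  have hbound (t : ℝ) (ht : 0 < t) : t * ‖⟪F s, F 1⟫_ℂ‖ ^ 2 ≤ ‖F s‖ ^ 2 * ‖F 1‖ ^ 2 := by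
    have hcs : (t * ‖⟪F s, F 1⟫_ℂ‖) ^ 2 ≤ ‖F s‖ ^ 2 * (t * ‖F 1‖ ^ 2) := by
      have := norm_inner_le_norm (𝕜 := ℂ) (F s) (F t)
      rw [hlinear ht.le, norm_smul, Real.norm_of_nonneg ht.le] at this
      calc _ ≤ (‖F s‖ * ‖F t‖) ^ 2 := by gcongr
        _ = _ := by rw [mul_pow, hF.norm_sq_eq hcont hδ t, abs_of_pos ht]
    refine le_of_mul_le_mul_left ?_ ht
    linarith
  have hzero : ⟪F s, F 1⟫_ℂ = 0 := by
    by_contra hne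
    have hpos : 0 < ‖⟪F s, F 1⟫_ℂ‖ ^ 2 := by positivity
    have := hbound ((‖F s‖ ^ 2 * ‖F 1‖ ^ 2 + 1) / ‖⟪F s, F 1⟫_ℂ‖ ^ 2) (by positivity)
    rw [div_mul_cancel₀ _ hpos.ne'] at this
    linarith
  rw [hlinear ht, hzero, smul_zero]

theorem inner_eq (s t : ℝ) :
    ⟪F s, F t⟫_ℂ = ((|s| + |t| - |s - t|) / 2 * ‖F 1‖ ^ 2 : ℝ) := by
  wlog hst : s ≤ t generalizing s t
  · rw [← inner_conj_symm, this t s (le_of_not_ge hst), Complex.conj_ofReal, abs_sub_comm,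
      add_comm |t|]
  have hself (s : ℝ) : ⟪F s, F s⟫_ℂ = (|s| * ‖F 1‖ ^ 2 : ℝ) := by
    rw [← hF.norm_sq_eq hcont hδ, inner_self_eq_norm_sq_to_K]
    norm_cast
  have hshift (s t : ℝ) : ⟪F s, F t⟫_ℂ = ⟪F s, F s⟫_ℂ - ⟪F (-s), F (t - s)⟫_ℂ := by
    have hadd := hF s (t - s)
    rw [add_sub_cancel] at hadd
    rw [hadd, inner_add_right, U.inner_op_right, hF.op_neg_self, inner_neg_left, ← sub_eq_add_neg]
  rw [abs_of_nonpos (sub_nonpos.2 hst)]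
  rcases le_total 0 s with hs | hs
  · rw [hshift, hF.inner_eq_zero hcont hδ (neg_nonpos.2 hs) (sub_nonneg.2 hst), hself, sub_zero,
      abs_of_nonneg hs, abs_of_nonneg (hs.trans hst)]
    ring_nf
  rcases le_total 0 t with ht | ht
  · rw [hF.inner_eq_zero hcont hδ hs ht, abs_of_nonpos hs, abs_of_nonneg ht,
      show -s + t - -(s - t) = 0 by ring, zero_div, zero_mul, Complex.ofReal_zero]
  · rw [← inner_conj_symm, hshift, ← inner_conj_symm (F (-t)),
      hF.inner_eq_zero hcont hδ (sub_nonpos.2 hst) (neg_nonneg.2 ht), hself, map_zero, sub_zero,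
      Complex.conj_ofReal, abs_of_nonpos hs, abs_of_nonpos ht]
    ring_nf

end UnitaryGroup.IsCocycle

end Cocycles

section Uniqueness

variable {K L : Type*} [NormedAddCommGroup K] [NormedAddCommGroup L]

theorem IsTotal.denseRange_linearCombination {ι 𝕜 : Type*} [RCLike 𝕜] [InnerProductSpace 𝕜 K]
    [CompleteSpace K] {v : ι → K} (hv : IsTotal 𝕜 (Set.range v)) :
    DenseRange (Finsupp.linearCombination 𝕜 v) := by
  rw [DenseRange, ← LinearMap.coe_range, Finsupp.range_linearCombination]
  exact hv.dense_span

theorem norm_linearCombination_eq_of_inner_eq {ι 𝕜 : Type*} [RCLike 𝕜] [InnerProductSpace 𝕜 K]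
    [InnerProductSpace 𝕜 L] {v : ι → K} {w : ι → L}
    (h : ∀ i j, ⟪v i, v j⟫_𝕜 = ⟪w i, w j⟫_𝕜) (x : ι →₀ 𝕜) :
    ‖Finsupp.linearCombination 𝕜 v x‖ = ‖Finsupp.linearCombination 𝕜 w x‖ := by
  rw [norm_eq_sqrt_re_inner (𝕜 := 𝕜), norm_eq_sqrt_re_inner (𝕜 := 𝕜)]
  simp only [Finsupp.linearCombination_apply, Finsupp.sum, sum_inner, inner_sum, inner_smul_left,
    inner_smul_right, h]

theorem exists_linearIsometryEquiv_of_inner_eq {ι 𝕜 : Type*} [RCLike 𝕜] [InnerProductSpace 𝕜 K]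
    [InnerProductSpace 𝕜 L] [CompleteSpace K] [CompleteSpace L] {v : ι → K} {w : ι → L}
    (hv : IsTotal 𝕜 (Set.range v)) (hw : IsTotal 𝕜 (Set.range w))
    (h : ∀ i j, ⟪v i, v j⟫_𝕜 = ⟪w i, w j⟫_𝕜) :
    ∃ W : K ≃ₗᵢ[𝕜] L, ∀ i, W (v i) = w i := by
  have hnorm (x : ι →₀ 𝕜) : ‖Finsupp.linearCombination 𝕜 w (LinearEquiv.refl 𝕜 _ x)‖ =
      ‖Finsupp.linearCombination 𝕜 v x‖ :=
    (norm_linearCombination_eq_of_inner_eq h x).symm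
  refine ⟨(LinearEquiv.refl 𝕜 (ι →₀ 𝕜)).extendOfIsometry _ _ hv.denseRange_linearCombination
    hw.denseRange_linearCombination hnorm, fun i => ?_⟩
  simpa using LinearEquiv.extendOfIsometry_eq _ _ _ hv.denseRange_linearCombination
    hw.denseRange_linearCombination hnorm (Finsupp.single i 1)

theorem UnitaryGroup.IsCocycle.exists_intertwining [InnerProductSpace ℂ K]
    [InnerProductSpace ℂ L] [CompleteSpace K] [CompleteSpace L]
    {U : UnitaryGroup K} {U' : UnitaryGroup L} {F : ℝ → K} {F' : ℝ → L}
    (hF : U.IsCocycle F) (hF' : U'.IsCocycle F') (htotal : IsTotal ℂ (Set.range F))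
    (htotal' : IsTotal ℂ (Set.range F')) (h : ∀ s t, ⟪F s, F t⟫_ℂ = ⟪F' s, F' t⟫_ℂ) :
    ∃ W : K ≃ₗᵢ[ℂ] L, (∀ t, W (F t) = F' t) ∧ ∀ t x, W (U.op t x) = U'.op t (W x) := by
  obtain ⟨W, hW⟩ := exists_linearIsometryEquiv_of_inner_eq htotal htotal' h
  refine ⟨W, hW, fun t x => ?_⟩
  have hext : ((U.op t).trans W : K →L[ℂ] L) = (W.trans (U'.op t) : K →L[ℂ] L) := by
    refine ContinuousLinearMap.ext_on htotal.dense_span ?_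
    rintro _ ⟨s, rfl⟩
    change W (U.op t (F s)) = U'.op t (W (F s))
    rw [hF.op_apply, map_sub, hW, hW, hW, hF'.op_apply]
  exact DFunLike.congr_fun hext x

end Uniqueness

section Steps

theorem ae_eq_zero_of_intervalIntegral_eq_zero {E : Type*} [NormedAddCommGroup E]
    [NormedSpace ℝ E] [CompleteSpace E] {f : ℝ → E} (hf : LocallyIntegrable f) {a : ℝ}
    (h : ∀ t, ∫ x in a..t, f x = 0) : f =ᵐ[volume] 0 := by
  filter_upwards [_root_.LocallyIntegrable.ae_hasDerivAt_integral hf] with x hx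
  have hderiv := hx a
  simp only [h] at hderiv
  exact hderiv.unique (hasDerivAt_const x 0)

theorem locallyIntegrable_coeFn (f : L2) : LocallyIntegrable (f : ℝ → ℂ) :=
  (Lp.memLp f).locallyIntegrable one_le_two

/-- The indicator function of `(0, t]` for `t ≥ 0`, and minus that of `(t, 0]` for `t ≤ 0`: the
integral from `0` to `t` of the moving point mass `δ(· - s)`. -/
def step (t : ℝ) : L2 :=
  indicatorConstLp 2 (measurableSet_Ioc (a := 0) (b := t)) measure_Ioc_lt_top.ne 1 -
    indicatorConstLp 2 (measurableSet_Ioc (a := t) (b := 0)) measure_Ioc_lt_top.ne 1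

theorem coeFn_step (t : ℝ) : ∀ᵐ x : ℝ, step t x =
    (if x ≤ t then (1 : ℂ) else 0) - if x ≤ 0 then 1 else 0 := by
  have hcoe (a b : ℝ) : ∀ᵐ x : ℝ, indicatorConstLp 2 (measurableSet_Ioc (a := a) (b := b))
      measure_Ioc_lt_top.ne (1 : ℂ) x = (Set.Ioc a b).indicator (fun _ => 1) x :=
    indicatorConstLp_coeFn (hs := measurableSet_Ioc) (hμs := measure_Ioc_lt_top.ne)
  filter_upwards [Lp.coeFn_sub
    (indicatorConstLp 2 (measurableSet_Ioc (a := 0) (b := t)) measure_Ioc_lt_top.ne (1 : ℂ))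
    (indicatorConstLp 2 (measurableSet_Ioc (a := t) (b := 0)) measure_Ioc_lt_top.ne (1 : ℂ)),
    hcoe 0 t, hcoe t 0] with x hsub h₁ h₂
  rw [step, hsub, Pi.sub_apply, h₁, h₂]
  simp only [Set.indicator_apply, Set.mem_Ioc, ← not_le]
  by_cases h₃ : x ≤ t <;> by_cases h₄ : x ≤ 0 <;> simp [h₃, h₄]

theorem inner_step_left (t : ℝ) (f : L2) : ⟪step t, f⟫_ℂ = ∫ x in (0 : ℝ)..t, f x := by
  rw [step, inner_sub_left, L2.inner_indicatorConstLp_one, L2.inner_indicatorConstLp_one,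
    intervalIntegral]

theorem inner_step_step (s t : ℝ) :
    ⟪step s, step t⟫_ℂ = ((|s| + |t| - |s - t|) / 2 : ℝ) := by
  simp only [step, inner_sub_left, inner_sub_right,
    L2.inner_indicatorConstLp_one_indicatorConstLp_one, Set.Ioc_inter_Ioc, Real.volume_real_Ioc]
  rw [← RCLike.ofReal_sub, ← RCLike.ofReal_sub, ← RCLike.ofReal_sub]
  refine congrArg Complex.ofReal ?_
  rcases le_total 0 s with hs | hs <;> rcases le_total 0 t with ht | ht <;>
    rcases le_total s t with hst | hst <;>
    simp [hs, ht, hst, abs_of_nonneg, abs_of_nonpos] <;> linarith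

theorem isTotal_range_step : IsTotal ℂ (Set.range step) := by
  refine fun f hf => Lp.eq_zero_iff_ae_eq_zero.2 ?_
  refine ae_eq_zero_of_intervalIntegral_eq_zero (locallyIntegrable_coeFn f) (a := 0) fun t => ?_
  rw [← inner_step_left, hf _ ⟨t, rfl⟩]

end Steps

section TranslationAndPhase

/-- The unitary group that consists of the given linear isometries, which are surjective because
of the group law. -/
def UnitaryGroup.ofLinearIsometry {H : Type*} [NormedAddCommGroup H] [InnerProductSpace ℂ H]
    (V : ℝ → H →ₗᵢ[ℂ] H) (hzero : ∀ x, V 0 x = x) (hadd : ∀ s t x, V (s + t) x = V s (V t x))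
    (hcont : ∀ x, Continuous fun t => V t x) : UnitaryGroup H where
  op t :=
    { (V t).toLinearMap with
      invFun := V (-t)
      left_inv := fun x => (hadd _ _ _).symm.trans (by rw [neg_add_cancel, hzero])
      right_inv := fun x => (hadd _ _ _).symm.trans (by rw [add_neg_cancel, hzero])
      norm_map' := (V t).norm_map }
  op_add := hadd
  continuous_op := hcont

/-- Translation `f ↦ f(· - t)` of `L²(ℝ)`. -/
def translate (t : ℝ) : L2 →ₗᵢ[ℂ] L2 :=
  Lp.compMeasurePreservingₗᵢ ℂ (fun x => x - t) (measurePreserving_sub_right volume t)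

theorem coeFn_translate (t : ℝ) (f : L2) : ∀ᵐ x : ℝ, translate t f x = f (x - t) :=
  Lp.coeFn_compMeasurePreserving f (measurePreserving_sub_right volume t)

theorem ae_comp_sub_right {p : ℝ → Prop} (h : ∀ᵐ x, p x) (t : ℝ) : ∀ᵐ x, p (x - t) :=
  (measurePreserving_sub_right volume t).quasiMeasurePreserving.ae h

theorem translate_zero (f : L2) : translate 0 f = f := by
  refine Lp.ext ?_
  filter_upwards [coeFn_translate 0 f] with x hx
  rw [hx, sub_zero]

theorem translate_add (s t : ℝ) (f : L2) :
    translate (s + t) f = translate s (translate t f) := by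
  refine Lp.ext ?_
  filter_upwards [coeFn_translate (s + t) f, coeFn_translate s (translate t f),
    ae_comp_sub_right (coeFn_translate t f) s] with x h₁ h₂ h₃
  rw [h₁, h₂, h₃, sub_sub]

theorem continuous_translate (f : L2) : Continuous fun t => translate t f := by
  let shift : C(ℝ, C(ℝ, ℝ)) := ContinuousMap.curry ⟨fun p : ℝ × ℝ => p.2 - p.1, by fun_prop⟩
  exact (continuous_const (y := f)).compMeasurePreservingLp shift.continuous
    (fun t => measurePreserving_sub_right volume t) (by simp)

/-- The group of translations of `L²(ℝ)`, whose generator is `-iħ ∂/∂τ`. -/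
def translationGroup : UnitaryGroup L2 :=
  .ofLinearIsometry translate translate_zero translate_add continuous_translate

theorem isCocycle_step : translationGroup.IsCocycle step := by
  intro s t
  rw [← sub_eq_iff_eq_add']
  refine Lp.ext ?_
  filter_upwards [Lp.coeFn_sub (step (s + t)) (step s), coeFn_translate s (step t),
    ae_comp_sub_right (coeFn_step t) s, coeFn_step s, coeFn_step (s + t)] with x h₁ h₂ h₃ h₄ h₅
  refine Eq.trans ?_ h₂.symm
  rw [h₁, Pi.sub_apply, h₃, h₄, h₅]
  simp only [sub_le_iff_le_add, zero_add, add_comm s t]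
  ring

section Unimodular

variable {X E : Type*} [MeasurableSpace X] {μ : Measure X} {p : ENNReal}
  [NormedAddCommGroup E] [NormedSpace ℂ E] {u : X → Circle}

theorem memLp_circle_smul (hu : AEStronglyMeasurable u μ) (f : Lp E p μ) :
    MemLp (fun x => (u x : ℂ) • f x) p μ :=
  (Lp.memLp f).of_le ((continuous_subtype_val.comp_aestronglyMeasurable hu).smul
    (Lp.aestronglyMeasurable f))
    (Eventually.of_forall fun x => by rw [norm_smul, Circle.norm_coe, one_mul])

variable [Fact (1 ≤ p)]

/-- Multiplication of `Lᵖ(μ)` by a function of absolute value `1`. -/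
def circleSMul (hu : AEStronglyMeasurable u μ) : Lp E p μ →ₗᵢ[ℂ] Lp E p μ where
  toFun f := (memLp_circle_smul hu f).toLp
  map_add' f g := by
    rw [← MemLp.toLp_add]
    refine MemLp.toLp_congr _ _ ?_
    filter_upwards [Lp.coeFn_add f g] with x hx
    simp only [hx, Pi.add_apply, smul_add]
  map_smul' c f := by
    rw [RingHom.id_apply, ← MemLp.toLp_const_smul]
    refine MemLp.toLp_congr _ _ ?_
    filter_upwards [Lp.coeFn_smul c f] with x hx
    simp only [hx, Pi.smul_apply, smul_comm c]
  norm_map' f := by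
    change ‖(memLp_circle_smul hu f).toLp‖ = _
    rw [Lp.norm_toLp, Lp.norm_def]
    congr 1
    exact eLpNorm_congr_norm_ae (Eventually.of_forall fun x => by
      rw [norm_smul, Circle.norm_coe, one_mul])

theorem coeFn_circleSMul (hu : AEStronglyMeasurable u μ) (f : Lp E p μ) :
    ∀ᵐ x ∂μ, circleSMul hu f x = (u x : ℂ) • f x :=
  (memLp_circle_smul hu f).coeFn_toLp

end Unimodular

variable {ħ : ℝ}

/-- The phase factor `exp (-i α τ / ħ)`. -/
def phase (ħ α τ : ℝ) : Circle := Circle.exp (-(α * τ / ħ))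

@[fun_prop]
theorem continuous_phase (ħ : ℝ) : Continuous fun p : ℝ × ℝ => phase ħ p.1 p.2 := by
  unfold phase
  fun_prop

theorem phase_add_left (ħ α β τ : ℝ) : phase ħ (α + β) τ = phase ħ α τ * phase ħ β τ := by
  rw [phase, phase, phase, ← Circle.exp_add]
  congr 1
  ring

theorem phase_add_right (ħ α σ τ : ℝ) : phase ħ α (σ + τ) = phase ħ α σ * phase ħ α τ := by
  rw [phase, phase, phase, ← Circle.exp_add]
  congr 1
  ring

theorem phase_zero (ħ τ : ℝ) : phase ħ 0 τ = 1 := by simp [phase]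

theorem coe_phase (ħ α τ : ℝ) : (phase ħ α τ : ℂ) = Complex.exp (-(Complex.I * α * τ / ħ)) := by
  rw [phase, Circle.coe_exp]
  congr 1
  push_cast
  ring

theorem hasDerivAt_phase (ħ α τ : ℝ) :
    HasDerivAt (fun α => (phase ħ α τ : ℂ)) ((Complex.I * ħ)⁻¹ * (τ * phase ħ α τ)) α := by
  have hlinear : HasDerivAt (fun α : ℝ => -(Complex.I * α * τ / ħ))
      (-(Complex.I * 1 * τ / ħ)) α :=
    (((Complex.ofRealCLM.hasDerivAt.const_mul Complex.I).mul_const (τ : ℂ)).div_const (ħ : ℂ)).neg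
  simp only [coe_phase]
  refine hlinear.cexp.congr_deriv ?_
  rw [mul_inv, Complex.inv_I]
  ring

/-- Multiplication by `exp (-i α τ / ħ)` in `L²(ℝ)`. -/
def mulPhase (ħ α : ℝ) : L2 →ₗᵢ[ℂ] L2 :=
  circleSMul (u := phase ħ α) (by fun_prop : Continuous (phase ħ α)).aestronglyMeasurable

theorem coeFn_mulPhase (ħ α : ℝ) (f : L2) : ∀ᵐ τ : ℝ, mulPhase ħ α f τ = phase ħ α τ * f τ :=
  coeFn_circleSMul _ f

theorem mulPhase_zero (ħ : ℝ) (f : L2) : mulPhase ħ 0 f = f := by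
  refine Lp.ext ?_
  filter_upwards [coeFn_mulPhase ħ 0 f] with τ hτ
  rw [hτ, phase_zero, Circle.coe_one, one_mul]

theorem mulPhase_add (ħ α β : ℝ) (f : L2) :
    mulPhase ħ (α + β) f = mulPhase ħ α (mulPhase ħ β f) := by
  refine Lp.ext ?_
  filter_upwards [coeFn_mulPhase ħ (α + β) f, coeFn_mulPhase ħ α (mulPhase ħ β f),
    coeFn_mulPhase ħ β f] with τ h₁ h₂ h₃
  rw [h₁, h₂, h₃, phase_add_left, Circle.coe_mul, mul_assoc]

theorem continuous_of_continuous_inner {X 𝕜 E : Type*} [TopologicalSpace X] [RCLike 𝕜]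
    [NormedAddCommGroup E] [InnerProductSpace 𝕜 E] {f : X → E}
    (hnorm : Continuous fun x => ‖f x‖) (hinner : ∀ y, Continuous fun x => ⟪y, f x⟫_𝕜) :
    Continuous f := by
  refine continuous_iff_continuousAt.2 fun x₀ => tendsto_iff_norm_sub_tendsto_zero.2 ?_
  have hsq : Continuous fun x => ‖f x‖ ^ 2 - 2 * RCLike.re ⟪f x₀, f x⟫_𝕜 + ‖f x₀‖ ^ 2 :=
    ((hnorm.pow 2).sub (continuous_const.mul (RCLike.continuous_re.comp (hinner _)))).add
      continuous_const
  refine Tendsto.congr (fun x => ?_) (hsq.sqrt.tendsto' x₀ 0 ?_)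
  · rw [inner_re_symm, ← norm_sub_sq, Real.sqrt_sq (norm_nonneg _)]
  · rw [← norm_sub_sq, sub_self, norm_zero, zero_pow two_ne_zero, Real.sqrt_zero]

theorem continuous_mulPhase (ħ : ℝ) (f : L2) : Continuous fun α => mulPhase ħ α f := by
  refine continuous_of_continuous_inner (𝕜 := ℂ) (by simp only [LinearIsometry.norm_map]; fun_prop)
    fun g => ?_
  have hinner (α : ℝ) : ⟪g, mulPhase ħ α f⟫_ℂ = ∫ τ, (phase ħ α τ : ℂ) * ⟪g τ, f τ⟫_ℂ := by
    rw [L2.inner_def]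
    refine integral_congr_ae ?_
    filter_upwards [coeFn_mulPhase ħ α f] with τ hτ
    rw [hτ, ← smul_eq_mul, inner_smul_right]
  simp only [hinner]
  have hint := L2.integrable_inner (𝕜 := ℂ) g f
  refine continuous_of_dominated (bound := fun τ => ‖⟪g τ, f τ⟫_ℂ‖) (fun α => ?_) (fun α => ?_)
    hint.norm ?_
  · exact AEStronglyMeasurable.mul (Continuous.aestronglyMeasurable (by fun_prop))
      hint.aestronglyMeasurable
  · exact Eventually.of_forall fun τ => by rw [norm_mul, Circle.norm_coe, one_mul]
  · exact Eventually.of_forall fun τ => by fun_prop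

/-- The group of multiplications by `exp (-i α τ / ħ)` in `L²(ℝ)`, whose generator is
multiplication by `τ`. -/
def phaseGroup (ħ : ℝ) : UnitaryGroup L2 :=
  .ofLinearIsometry (mulPhase ħ) (mulPhase_zero ħ) (mulPhase_add ħ) (continuous_mulPhase ħ)

theorem weylRelations_phase_translation (ħ : ℝ) :
    WeylRelations ħ (phaseGroup ħ) translationGroup := by
  intro α t f
  refine Lp.ext ?_
  filter_upwards [coeFn_mulPhase ħ α (translate t f), coeFn_translate t f,
    Lp.coeFn_smul (Complex.exp (-(Complex.I * α * t / ħ))) (translate t (mulPhase ħ α f)),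
    coeFn_translate t (mulPhase ħ α f), ae_comp_sub_right (coeFn_mulPhase ħ α f) t]
    with x h₁ h₂ h₃ h₄ h₅
  refine h₁.trans (Eq.trans ?_ h₃.symm)
  rw [h₂, Pi.smul_apply, h₄, h₅, smul_eq_mul, ← mul_assoc, ← coe_phase, ← Circle.coe_mul,
    ← phase_add_right, add_sub_cancel]

end TranslationAndPhase

section Generators

/-- The class in `L²(ℝ)` of a continuous real function with compact support; these vectors turn
`∫ η f` into an inner product. -/
def testVector (η : ℝ → ℝ) (hη : Continuous η) (hs : HasCompactSupport η) : L2 :=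
  ((Complex.continuous_ofReal.comp hη).memLp_of_hasCompactSupport
    (hs.comp_left Complex.ofReal_zero)).toLp

theorem inner_testVector {η : ℝ → ℝ} (hη : Continuous η) (hs : HasCompactSupport η) (f : L2) :
    ⟪testVector η hη hs, f⟫_ℂ = ∫ τ, η τ • f τ := by
  have hcoe : ∀ᵐ τ : ℝ, testVector η hη hs τ = (η τ : ℂ) := MemLp.coeFn_toLp _
  rw [L2.inner_def]
  refine integral_congr_ae ?_
  filter_upwards [hcoe] with τ hτ
  rw [hτ, RCLike.inner_apply', Complex.conj_ofReal, Complex.real_smul]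

theorem isTotal_testVector : IsTotal ℂ {φ : L2 | ∃ (η : ℝ → ℝ) (hη : ContDiff ℝ ∞ η)
    (hs : HasCompactSupport η), testVector η hη.continuous hs = φ} := by
  refine fun f hf => Lp.eq_zero_iff_ae_eq_zero.2 (ae_eq_zero_of_integral_contDiff_smul_eq_zero
    (locallyIntegrable_coeFn f) fun η hη hs => ?_)
  rw [← inner_testVector hη.continuous hs, hf _ ⟨η, hη, hs, rfl⟩]

theorem UnitaryGroup.mem_graph_hamiltonian_iff_integral {ħ : ℝ} (hħ : ħ ≠ 0)
    (U : UnitaryGroup L2) {f g : L2} :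
    (f, g) ∈ (U.hamiltonian ħ).graph ↔
      ∀ η : ℝ → ℝ, ContDiff ℝ ∞ η → HasCompactSupport η → ∀ t,
        HasDerivAt (fun s => ∫ τ, η τ • U.op s f τ)
          ((Complex.I * ħ)⁻¹ * ∫ τ, η τ • U.op t g τ) t := by
  rw [U.mem_graph_hamiltonian_iff_of_isTotal hħ isTotal_testVector]
  constructor
  · intro h η hη hs t
    simpa only [inner_testVector] using h _ ⟨η, hη, hs, rfl⟩ t
  · rintro h _ ⟨η, hη, hs, rfl⟩ t
    simpa only [inner_testVector] using h η hη hs t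

theorem hasDerivAt_integral_comp_add_smul {E : Type*} [NormedAddCommGroup E] [NormedSpace ℝ E]
    {f : ℝ → E} (hf : LocallyIntegrable f) {η : ℝ → ℝ} (hη : ContDiff ℝ 1 η)
    (hs : HasCompactSupport η) (t : ℝ) :
    HasDerivAt (fun t => ∫ x, η (x + t) • f x) (∫ x, deriv η (x + t) • f x) t := by
  have hconvolution := (hs.comp_homeomorph (Homeomorph.neg ℝ)).hasDerivAt_convolution_right
    (ContinuousLinearMap.lsmul ℝ ℝ).flip hf (hη.comp contDiff_neg) (-t)
  have hderiv : deriv (η ∘ Homeomorph.neg ℝ) = fun y => -deriv η (-y) :=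
    funext fun y => deriv_comp_neg η y
  refine ((hconvolution.scomp t (hasDerivAt_neg t)).congr_deriv ?_).congr_of_eventuallyEq
    (Eventually.of_forall fun s => ?_)
  · simp only [hderiv, convolution_def, ContinuousLinearMap.flip_apply,
      ContinuousLinearMap.lsmul_apply, neg_smul, one_smul, integral_neg, neg_neg, neg_sub,
      sub_neg_eq_add]
  · simp only [convolution_def, ContinuousLinearMap.flip_apply, ContinuousLinearMap.lsmul_apply,
      Homeomorph.coe_neg, neg_sub, sub_neg_eq_add, Function.comp_apply]

theorem integral_smul_translationGroup_op (η : ℝ → ℝ) (t : ℝ) (f : L2) :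
    ∫ x, η x • translationGroup.op t f x = ∫ x, η (x + t) • f x := by
  rw [← integral_sub_right_eq_self (fun x => η (x + t) • f x) t]
  refine integral_congr_ae ?_
  filter_upwards [coeFn_translate t f] with x hx
  rw [sub_add_cancel]
  exact congrArg (η x • ·) hx

theorem hamiltonian_translationGroup {ħ : ℝ} (hħ : ħ ≠ 0) :
    translationGroup.hamiltonian ħ = translationHamiltonian ħ := by
  have hc : Complex.I * ħ ≠ 0 := mul_ne_zero Complex.I_ne_zero (Complex.ofReal_ne_zero.2 hħ)
  refine LinearPMap.eq_of_eq_graph ?_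
  rw [translationHamiltonian_graph]
  ext ⟨f, g⟩
  rw [UnitaryGroup.mem_graph_hamiltonian_iff_integral hħ]
  simp only [integral_smul_translationGroup_op]
  have hderiv {η : ℝ → ℝ} (hη : ContDiff ℝ ∞ η) (hs : HasCompactSupport η) (t : ℝ) :=
    hasDerivAt_integral_comp_add_smul (locallyIntegrable_coeFn f) (hη.of_le (by simp)) hs t
  constructor
  · intro h η hη hs
    have huniq := (h η hη hs 0).unique (hderiv hη hs 0)
    simp only [add_zero] at huniq
    rw [← huniq, mul_inv_cancel_left₀ hc]
  · intro h η hη hs t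
    have hshift := h (fun x => η (x + t)) (hη.comp (contDiff_id.add contDiff_const))
      (hs.comp_homeomorph (Homeomorph.addRight t))
    simp only [deriv_comp_add_const] at hshift
    rw [hshift, inv_mul_cancel_left₀ hc]
    exact hderiv hη hs t

theorem hasDerivAt_integral_smul_phase_mul (ħ : ℝ) {f : ℝ → ℂ} (hf : LocallyIntegrable f)
    {η : ℝ → ℝ} (hη : Continuous η) (hs : HasCompactSupport η) (α : ℝ) :
    HasDerivAt (fun α => ∫ τ, η τ • (phase ħ α τ * f τ))
      ((Complex.I * ħ)⁻¹ * ∫ τ, η τ • (phase ħ α τ * ((τ : ℂ) * f τ))) α := by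
  have hint : Integrable fun τ : ℝ => η τ • (τ • f τ) :=
    (hf.continuous_smul continuous_id).integrable_smul_left_of_hasCompactSupport hη hs
  have hphase (α : ℝ) : Continuous fun τ => (phase ħ α τ : ℂ) := by fun_prop
  rw [← integral_const_mul]
  refine (hasDerivAt_integral_of_dominated_loc_of_deriv_le (𝕜 := ℝ) (s := Set.univ)
    (F := fun α τ => η τ • (phase ħ α τ * f τ))
    (F' := fun α τ => (Complex.I * ħ)⁻¹ * (η τ • (phase ħ α τ * ((τ : ℂ) * f τ))))
    (bound := fun τ => ‖(Complex.I * ħ)⁻¹‖ * ‖η τ • (τ • f τ)‖) univ_mem ?_ ?_ ?_ ?_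
    (hint.norm.const_mul _) ?_).2
  · exact Eventually.of_forall fun α => hη.aestronglyMeasurable.smul
      ((hphase α).aestronglyMeasurable.mul hf.aestronglyMeasurable)
  · exact (hf.continuous_mul (hphase α)).integrable_smul_left_of_hasCompactSupport hη hs
  · exact (hη.aestronglyMeasurable.smul ((hphase α).aestronglyMeasurable.mul
      (Complex.continuous_ofReal.aestronglyMeasurable.mul
        hf.aestronglyMeasurable))).const_mul _
  · refine Eventually.of_forall fun τ β _ => ?_
    rw [norm_mul, norm_smul, norm_mul, Circle.norm_coe, one_mul, norm_smul, norm_smul, norm_mul,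
      Complex.norm_real]
  · refine Eventually.of_forall fun τ β _ => ?_
    refine (((hasDerivAt_phase ħ β τ).mul_const (f τ)).const_smul (η τ)).congr_deriv ?_
    rw [Complex.real_smul, Complex.real_smul]
    ring

theorem integral_smul_phaseGroup_op (ħ : ℝ) (η : ℝ → ℝ) (α : ℝ) (f : L2) :
    ∫ τ, η τ • (phaseGroup ħ).op α f τ = ∫ τ, η τ • (phase ħ α τ * f τ) := by
  refine integral_congr_ae ?_
  filter_upwards [coeFn_mulPhase ħ α f] with τ hτ
  exact congrArg (η τ • ·) hτ

theorem hamiltonian_phaseGroup {ħ : ℝ} (hħ : ħ ≠ 0) :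
    (phaseGroup ħ).hamiltonian ħ = positionOperator := by
  have hc : Complex.I * ħ ≠ 0 := mul_ne_zero Complex.I_ne_zero (Complex.ofReal_ne_zero.2 hħ)
  refine LinearPMap.eq_of_eq_graph ?_
  rw [positionOperator_graph]
  ext ⟨f, g⟩
  rw [UnitaryGroup.mem_graph_hamiltonian_iff_integral hħ]
  simp only [integral_smul_phaseGroup_op]
  have hderiv {η : ℝ → ℝ} (hη : Continuous η) (hs : HasCompactSupport η) (α : ℝ) :=
    hasDerivAt_integral_smul_phase_mul ħ (locallyIntegrable_coeFn f) hη hs α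
  constructor
  · intro h
    refine ae_eq_of_integral_contDiff_smul_eq (locallyIntegrable_coeFn g)
      ((locallyIntegrable_coeFn f).continuous_mul Complex.continuous_ofReal) fun η hη hs => ?_
    have huniq := (h η hη hs 0).unique (hderiv hη.continuous hs 0)
    simpa only [phase_zero, Circle.coe_one, one_mul] using mul_left_cancel₀ (inv_ne_zero hc) huniq
  · intro h η hη hs α
    refine (hderiv hη.continuous hs α).congr_deriv (congrArg _ (integral_congr_ae ?_))
    have hmul : ∀ᵐ τ : ℝ, g τ = τ * f τ := h
    filter_upwards [hmul] with τ hτ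
    rw [hτ]

end Generators

section CanonicalPair

/-- Membership in `C_c^∞(ℝ)` of an element of `L²(ℝ)`. -/
def IsTest (f : L2) : Prop :=
  ∃ g : ℝ → ℂ, f =ᵐ[volume] g ∧ HasCompactSupport g ∧ ContDiff ℝ ∞ g

theorem dense_isTest : Dense {f : L2 | IsTest f} :=
  Lp.dense_hasCompactSupport_contDiff (by simp)

theorem exists_isTest_coeFn {g : ℝ → ℂ} (hc : HasCompactSupport g) (hg : ContDiff ℝ ∞ g) :
    ∃ f : L2, IsTest f ∧ f =ᵐ[volume] g :=
  have h : MemLp g 2 volume := hg.continuous.memLp_of_hasCompactSupport hc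
  ⟨h.toLp, ⟨g, h.coeFn_toLp, hc, hg⟩, h.coeFn_toLp⟩

theorem IsTest.exists_position {f : L2} (hf : IsTest f) :
    ∃ p, IsTest p ∧ (f, p) ∈ positionOperator.graph := by
  obtain ⟨g, hfg, hc, hg⟩ := hf
  obtain ⟨p, hp, hpg⟩ := exists_isTest_coeFn (g := fun τ => (τ : ℂ) * g τ) hc.mul_left
    (Complex.ofRealCLM.contDiff.mul hg)
  refine ⟨p, hp, ?_⟩
  rw [positionOperator_graph]
  change ∀ᵐ τ : ℝ, p τ = (τ : ℂ) * f τ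
  filter_upwards [hfg, hpg] with τ hf hp
  rw [hf, hp]

theorem integral_smul_deriv_eq_neg_of_hasCompactSupport {η : ℝ → ℝ} {g : ℝ → ℂ}
    (hη : ContDiff ℝ 1 η) (hg : ContDiff ℝ 1 g) (hc : HasCompactSupport g) :
    ∫ τ, η τ • deriv g τ = -∫ τ, deriv η τ • g τ := by
  simp only [Complex.real_smul]
  have hη' : Continuous fun τ => (η τ : ℂ) := Complex.continuous_ofReal.comp hη.continuous
  have hderiv : Continuous fun τ => ((deriv η τ : ℝ) : ℂ) :=
    Complex.continuous_ofReal.comp (hη.continuous_deriv le_rfl)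
  refine integral_mul_deriv_eq_deriv_mul_of_integrable
    (fun τ _ => ((hη.differentiable one_ne_zero).differentiableAt.hasDerivAt (x := τ)).ofReal_comp)
    (fun τ _ => (hg.differentiable one_ne_zero).differentiableAt.hasDerivAt) ?_ ?_ ?_
  · exact (hη'.mul (hg.continuous_deriv le_rfl)).integrable_of_hasCompactSupport hc.deriv.mul_left
  · exact (hderiv.mul hg.continuous).integrable_of_hasCompactSupport hc.mul_left
  · exact (hη'.mul hg.continuous).integrable_of_hasCompactSupport hc.mul_left

theorem IsTest.exists_translation {f : L2} (hf : IsTest f) (ħ : ℝ) :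
    ∃ p, IsTest p ∧ (f, p) ∈ (translationHamiltonian ħ).graph := by
  obtain ⟨g, hfg, hc, hg⟩ := hf
  obtain ⟨p, hp, hpg⟩ := exists_isTest_coeFn (g := fun τ => -(Complex.I * ħ) * deriv g τ)
    hc.deriv.mul_left (contDiff_const.mul (contDiff_infty_iff_deriv.1 hg).2)
  refine ⟨p, hp, ?_⟩
  rw [translationHamiltonian_graph]
  intro η hη _
  calc ∫ τ, η τ • p τ
      = ∫ τ, -(Complex.I * ħ) * (η τ • deriv g τ) := by
        refine integral_congr_ae ?_
        filter_upwards [hpg] with τ hτ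
        rw [hτ, mul_smul_comm]
    _ = (Complex.I * ħ) * ∫ τ, deriv η τ • g τ := by
        rw [integral_const_mul, integral_smul_deriv_eq_neg_of_hasCompactSupport
          (hη.of_le (by simp)) (hg.of_le (by simp)) hc, neg_mul_neg]
    _ = (Complex.I * ħ) * ∫ τ, deriv η τ • f τ := by
        refine congrArg _ (integral_congr_ae ?_)
        filter_upwards [hfg] with τ hτ
        rw [hτ]

theorem dense_commutatorDomain_position_translation (ħ : ℝ) :
    Dense (commutatorDomain positionOperator (translationHamiltonian ħ)) := by
  refine dense_isTest.mono fun f hf => ?_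
  obtain ⟨Tf, hTf, hT⟩ := hf.exists_position
  obtain ⟨Af, hAf, hA⟩ := hf.exists_translation ħ
  obtain ⟨TAf, -, hTA⟩ := hAf.exists_position
  obtain ⟨ATf, -, hAT⟩ := hTf.exists_translation ħ
  exact ⟨Tf, Af, TAf, ATf, hT, hA, hTA, hAT⟩

theorem isCanonicalConjugate_position_translation {ħ : ℝ} (hħ : ħ ≠ 0) :
    IsCanonicalConjugate ħ positionOperator (translationHamiltonian ħ) := by
  rw [← hamiltonian_phaseGroup hħ, ← hamiltonian_translationGroup hħ]
  refine isCanonicalConjugate_of_weyl hħ (weylRelations_phase_translation ħ) ?_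
  rw [hamiltonian_phaseGroup hħ, hamiltonian_translationGroup hħ]
  exact dense_commutatorDomain_position_translation ħ

end CanonicalPair

section GeneralizedVectors

theorem exists_inner_add_inner_eq {𝕜 E F : Type*} [RCLike 𝕜] [NormedAddCommGroup E]
    [NormedAddCommGroup F] [InnerProductSpace 𝕜 E] [InnerProductSpace 𝕜 F] [CompleteSpace E]
    [CompleteSpace F] (ℓ : StrongDual 𝕜 (E × F)) :
    ∃ (u : E) (v : F), ∀ x y, ℓ (x, y) = ⟪u, x⟫_𝕜 + ⟪v, y⟫_𝕜 := by
  refine ⟨(InnerProductSpace.toDual 𝕜 E).symm (ℓ.comp (.inl 𝕜 E F)),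
    (InnerProductSpace.toDual 𝕜 F).symm (ℓ.comp (.inr 𝕜 E F)), fun x y => ?_⟩
  simp only [InnerProductSpace.toDual_symm_apply, ContinuousLinearMap.comp_apply,
    ContinuousLinearMap.inl_apply, ContinuousLinearMap.inr_apply, ← map_add, Prod.mk_add_mk,
    add_zero, zero_add]

variable {H : Type*} [NormedAddCommGroup H] [InnerProductSpace ℂ H]

namespace GeneralizedVector

variable {A : H →ₗ.[ℂ] H} (ψ : GeneralizedVector A)

/-- The linear functional `(φ, A φ) ↦ conj ⟨φ|ψ⟩` on the graph of `A`. -/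
def graphFunctional : A.graph →ₗ[ℂ] ℂ :=
  (starLinearEquiv ℂ).toLinearMap.comp (ψ.pair.comp
    (((LinearMap.fst ℂ H H).domRestrict A.graph).codRestrict A.domain
      fun p => LinearPMap.mem_domain_of_mem_graph p.2))

theorem norm_graphFunctional_le : ∃ C : ℝ, ∀ p, ‖ψ.graphFunctional p‖ ≤ C * ‖p‖ := by
  obtain ⟨C, hC⟩ := ψ.bounded
  refine ⟨|C| * 2, fun p => ?_⟩
  have hdom : p.1.1 ∈ A.domain := LinearPMap.mem_domain_of_mem_graph p.2
  have happ : A ⟨p.1.1, hdom⟩ = p.1.2 := A.mem_graph_snd_inj (A.mem_graph ⟨p.1.1, hdom⟩) p.2 rfl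
  calc ‖ψ.graphFunctional p‖ = ‖ψ.pair ⟨p.1.1, hdom⟩‖ := norm_star _
    _ ≤ C * (‖p.1.1‖ + ‖p.1.2‖) := happ ▸ hC ⟨p.1.1, hdom⟩
    _ ≤ |C| * (‖p‖ + ‖p‖) := by
      gcongr
      exacts [le_abs_self C, norm_fst_le p.1, norm_snd_le p.1]
    _ = |C| * 2 * ‖p‖ := by ring

-- The graph norm makes `D(A)` a subspace of `H × H`, to which Hahn–Banach and Riesz apply.
theorem exists_pair_eq [CompleteSpace H] :
    ∃ u v : H, ∀ φ : A.domain, ψ.pair φ = ⟪(φ : H), u⟫_ℂ + ⟪A φ, v⟫_ℂ := by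
  obtain ⟨ℓ, hℓ, -⟩ := exists_extension_norm_eq A.graph
    (ψ.graphFunctional.mkContinuousOfExistsBound ψ.norm_graphFunctional_le)
  obtain ⟨u, v, huv⟩ := exists_inner_add_inner_eq ℓ
  refine ⟨u, v, fun φ => star_injective ?_⟩
  have hφ : ℓ ((φ : H), A φ) = star (ψ.pair φ) := hℓ ⟨_, A.mem_graph φ⟩
  rw [← hφ, huv, star_add, Complex.star_def, inner_conj_symm, inner_conj_symm]

end GeneralizedVector

end GeneralizedVectors

section Histories

variable {H : Type*} [NormedAddCommGroup H] [InnerProductSpace ℂ H] {ħ : ℝ} {U : UnitaryGroup H}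
  {ψ : GeneralizedVector (U.hamiltonian ħ)}

theorem evolve_zero_pair (φ : (U.hamiltonian ħ).domain) :
    (U.evolve ħ ψ 0).pair φ = ψ.pair φ :=
  congrArg ψ.pair (Subtype.ext (by simp only [neg_zero, U.op_zero]))

theorem evolve_evolve_pair (s t : ℝ) (φ : (U.hamiltonian ħ).domain) :
    (U.evolve ħ (U.evolve ħ ψ s) t).pair φ = (U.evolve ħ ψ (s + t)).pair φ :=
  congrArg ψ.pair (Subtype.ext (by simp only [neg_add, U.op_add]))

theorem evolve_pair_eq {u v : H}
    (h : ∀ φ : (U.hamiltonian ħ).domain, ψ.pair φ = ⟪(φ : H), u⟫_ℂ + ⟪U.hamiltonian ħ φ, v⟫_ℂ)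
    (t : ℝ) (φ : (U.hamiltonian ħ).domain) :
    (U.evolve ħ ψ t).pair φ = ⟪(φ : H), U.op t u⟫_ℂ + ⟪U.hamiltonian ħ φ, U.op t v⟫_ℂ := by
  rw [U.inner_op_right, U.inner_op_right, ← U.hamiltonian_op]
  exact h _

theorem isHistoryIntegral_evolve_iff {t a b : ℝ} {x : H} :
    IsHistoryIntegral U ħ (U.evolve ħ ψ t) a b x ↔ IsHistoryIntegral U ħ ψ (t + a) (t + b) x := by
  refine forall_congr' fun φ => ?_
  simp only [evolve_evolve_pair,
    intervalIntegral.integral_comp_add_left fun s => (U.evolve ħ ψ s).pair φ]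

theorem IsHistoryIntegral.op_evolve {a b : ℝ} {x : H} (h : IsHistoryIntegral U ħ ψ a b x) (t : ℝ) :
    IsHistoryIntegral U ħ (U.evolve ħ ψ t) a b (U.op t x) := by
  intro φ
  rw [U.inner_op_right, h ⟨U.op (-t) φ, U.op_mem_domain ħ (-t) φ.2⟩]
  refine intervalIntegral.integral_congr fun s _ => congrArg ψ.pair (Subtype.ext ?_)
  exact U.op_comm _ _ _

/-- The curve `F` is the primitive `t ↦ ∫_0^t ψ(s) ds` of the history of `ψ`, through which the
generalized states `ψ(t)` are accessible inside `H`. -/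
structure IsHistoryPrimitive (U : UnitaryGroup H) (ħ : ℝ) (ψ : GeneralizedVector (U.hamiltonian ħ))
    (F : ℝ → H) : Prop where
  continuous : Continuous F
  isHistoryIntegral : ∀ t, IsHistoryIntegral U ħ ψ 0 t (F t)

theorem IsHistoryPrimitive.mem_historySpace {F : ℝ → H} (hF : IsHistoryPrimitive U ħ ψ F)
    (t : ℝ) : F t ∈ historySpace U ħ ψ :=
  Submodule.le_topologicalClosure _ (Submodule.subset_span ⟨0, t, hF.isHistoryIntegral t⟩)

/-- The primitive `F` of a history, as a curve in the history space. -/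
def IsHistoryPrimitive.curve {F : ℝ → H} (hF : IsHistoryPrimitive U ħ ψ F) (t : ℝ) :
    historySpace U ħ ψ :=
  ⟨F t, hF.mem_historySpace t⟩

variable [CompleteSpace H]

theorem IsHistoryIntegral.unique {a b : ℝ} {x y : H} (hx : IsHistoryIntegral U ħ ψ a b x)
    (hy : IsHistoryIntegral U ħ ψ a b y) : x = y :=
  (U.dense_domain ħ).eq_of_inner_right ℂ fun φ hφ => (hx ⟨φ, hφ⟩).trans (hy ⟨φ, hφ⟩).symm

theorem continuous_evolve_pair (ψ : GeneralizedVector (U.hamiltonian ħ))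
    (φ : (U.hamiltonian ħ).domain) : Continuous fun t => (U.evolve ħ ψ t).pair φ := by
  obtain ⟨u, v, h⟩ := ψ.exists_pair_eq
  simp only [evolve_pair_eq h]
  exact (continuous_const.inner (U.continuous_op u)).add
    (continuous_const.inner (U.continuous_op v))

-- If `ψ = u + Ĥ v`, then `ψ(s) = U(s) u + iħ d/ds U(s) v`, which is integrated explicitly.
theorem exists_isHistoryPrimitive (hħ : ħ ≠ 0) (ψ : GeneralizedVector (U.hamiltonian ħ)) :
    ∃ F, IsHistoryPrimitive U ħ ψ F := by
  obtain ⟨u, v, h⟩ := ψ.exists_pair_eq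
  have hint (x : H) (t : ℝ) : IntervalIntegrable (fun s => U.op s x) volume 0 t :=
    (U.continuous_op x).intervalIntegrable 0 t
  refine ⟨fun t => (∫ s in (0 : ℝ)..t, U.op s u) + (Complex.I * ħ) • (U.op t v - v),
    ?_, fun t φ => ?_⟩
  · exact (intervalIntegral.continuous_primitive
      (fun a b => (U.continuous_op u).intervalIntegrable a b) 0).add
        (((U.continuous_op v).sub continuous_const).const_smul _)
  · have hinner (x y : H) : ∫ s in (0 : ℝ)..t, ⟪x, U.op s y⟫_ℂ =
        ⟪x, ∫ s in (0 : ℝ)..t, U.op s y⟫_ℂ :=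
      (innerSL ℂ x).intervalIntegral_comp_comm (hint y t)
    simp only [evolve_pair_eq h]
    rw [intervalIntegral.integral_add
      ((continuous_const.inner (U.continuous_op u)).intervalIntegrable 0 t)
      ((continuous_const.inner (U.continuous_op v)).intervalIntegrable 0 t), hinner, hinner,
      inner_add_right]
    congr 1
    exact (U.inner_hamiltonian_symm hħ ((U.hamiltonian ħ).mem_graph φ)
      (U.mem_graph_integral_op ħ v t)).symm

end Histories

section HistoryPrimitives

variable {H : Type*} [NormedAddCommGroup H] [InnerProductSpace ℂ H] [CompleteSpace H]
  {ħ : ℝ} {U : UnitaryGroup H} {ψ : GeneralizedVector (U.hamiltonian ħ)} {F : ℝ → H}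

namespace IsHistoryPrimitive

theorem hasDerivAt_inner (hF : IsHistoryPrimitive U ħ ψ F) (φ : (U.hamiltonian ħ).domain) (t : ℝ) :
    HasDerivAt (fun t => ⟪(φ : H), F t⟫_ℂ) ((U.evolve ħ ψ t).pair φ) t := by
  simp only [hF.isHistoryIntegral _ φ]
  exact ((continuous_evolve_pair ψ φ).integral_hasStrictDerivAt 0 t).hasDerivAt

theorem isHistoryIntegral_iff (hF : IsHistoryPrimitive U ħ ψ F) {a b : ℝ} {x : H} :
    IsHistoryIntegral U ħ ψ a b x ↔ x = F b - F a := by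
  have hsub : IsHistoryIntegral U ħ ψ a b (F b - F a) := fun φ => by
    rw [inner_sub_right, hF.isHistoryIntegral b φ, hF.isHistoryIntegral a φ]
    have hcont := continuous_evolve_pair ψ φ
    exact intervalIntegral.integral_interval_sub_left (hcont.intervalIntegrable _ _)
      (hcont.intervalIntegrable _ _)
  exact ⟨fun h => h.unique hsub, fun h => h ▸ hsub⟩

theorem isCocycle (hF : IsHistoryPrimitive U ħ ψ F) : U.IsCocycle F := by
  intro s t
  have h := hF.isHistoryIntegral_iff.1
    (isHistoryIntegral_evolve_iff.1 ((hF.isHistoryIntegral t).op_evolve s))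
  rw [h, add_zero, add_sub_cancel]

theorem tendsto_of_distinguishable (hF : IsHistoryPrimitive U ħ ψ F) {s t : ℝ}
    (h : Distinguishable U ħ (U.evolve ħ ψ s) (U.evolve ħ ψ t)) :
    Tendsto (fun ε : ℝ => (ε ^ 2)⁻¹ • ⟪U.op s (F ε), U.op t (F ε)⟫_ℂ) (𝓝[>] 0) (𝓝 0) := by
  obtain ⟨x, y, hxy, hlim⟩ := h
  refine hlim.congr' ?_
  filter_upwards [self_mem_nhdsWithin] with ε hε
  obtain ⟨hx, hy⟩ := hxy ε hε
  rw [hx.unique ((hF.isHistoryIntegral ε).op_evolve s),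
    hy.unique ((hF.isHistoryIntegral ε).op_evolve t), inner_smul_left, inner_smul_right,
    map_inv₀, Complex.conj_ofReal, ← mul_assoc, ← mul_inv, ← sq, ← Complex.ofReal_pow,
    ← Complex.ofReal_inv, Complex.real_smul]

theorem deltaCorrelated (hF : IsHistoryPrimitive U ħ ψ F)
    (hdist : (∀ t < 0, Distinguishable U ħ (U.evolve ħ ψ t) (U.evolve ħ ψ 0)) ∨
      (∀ t > 0, Distinguishable U ħ (U.evolve ħ ψ t) (U.evolve ħ ψ 0))) :
    U.DeltaCorrelated F := by
  intro t ht
  rcases hdist with hneg | hpos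
  · simpa only [U.inner_op_left, neg_neg, U.op_zero] using
      hF.tendsto_of_distinguishable (hneg (-t) (neg_lt_zero.2 ht))
  · have hconj := (Complex.continuous_conj.tendsto _).comp
      (hF.tendsto_of_distinguishable (hpos t ht))
    rw [map_zero] at hconj
    refine hconj.congr fun ε => ?_
    rw [Function.comp_apply, Complex.real_smul, map_mul, Complex.conj_ofReal, inner_conj_symm,
      U.op_zero, Complex.real_smul]

theorem historySpace_eq (hF : IsHistoryPrimitive U ħ ψ F) :
    historySpace U ħ ψ = (Submodule.span ℂ (Set.range F)).topologicalClosure := by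
  unfold historySpace
  congr 1
  refine le_antisymm (Submodule.span_le.2 ?_) (Submodule.span_mono ?_)
  · rintro v ⟨a, b, h⟩
    rw [hF.isHistoryIntegral_iff.1 h]
    exact Submodule.sub_mem _ (Submodule.subset_span ⟨b, rfl⟩) (Submodule.subset_span ⟨a, rfl⟩)
  · rintro _ ⟨t, rfl⟩
    exact ⟨0, t, hF.isHistoryIntegral t⟩

theorem op_mem_historySpace (hF : IsHistoryPrimitive U ħ ψ F) (t : ℝ) (x : H)
    (hx : x ∈ historySpace U ħ ψ) : U.op t x ∈ historySpace U ħ ψ := by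
  have hspan : Submodule.span ℂ (Set.range F) ≤
      (historySpace U ħ ψ).comap (U.op t).toLinearEquiv.toLinearMap := by
    refine Submodule.span_le.2 (Set.range_subset_iff.2 fun s => ?_)
    change U.op t (F s) ∈ historySpace U ħ ψ
    rw [hF.isCocycle.op_apply]
    exact Submodule.sub_mem _ (hF.mem_historySpace _) (hF.mem_historySpace _)
  have hclosed : IsClosed (historySpace U ħ ψ : Set H) := Submodule.isClosed_topologicalClosure _
  rw [hF.historySpace_eq] at hx
  exact Submodule.topologicalClosure_minimal _ hspan (hclosed.preimage (U.op t).continuous) hx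

theorem isCocycle_curve (hF : IsHistoryPrimitive U ħ ψ F) :
    (U.restrict hF.op_mem_historySpace).IsCocycle hF.curve :=
  fun s t => Subtype.ext (hF.isCocycle s t)

theorem isTotal_range_curve (hF : IsHistoryPrimitive U ħ ψ F) : IsTotal ℂ (Set.range hF.curve) :=
  isTotal_range_of_le_topologicalClosure hF.historySpace_eq.le

theorem apply_one_ne_zero (hF : IsHistoryPrimitive U ħ ψ F) (hψ : ψ.pair ≠ 0)
    (hδ : U.DeltaCorrelated F) : F 1 ≠ 0 := by
  intro h1
  have hzero (t : ℝ) : F t = 0 := by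
    simpa [h1] using hF.isCocycle.norm_sq_eq hF.continuous hδ t
  refine hψ (LinearMap.ext fun φ => ?_)
  have hderiv := hF.hasDerivAt_inner φ 0
  simp only [hzero, inner_zero_right, evolve_zero_pair] at hderiv
  exact hderiv.unique (hasDerivAt_const _ _)

-- The scalar products of the rescaled curve are those of the steps, so that the history space with
-- its evolution is a copy of `L²(ℝ)` with the translations.
theorem exists_representation (hF : IsHistoryPrimitive U ħ ψ F) (hψ : ψ.pair ≠ 0)
    (hδ : U.DeltaCorrelated F) :
    ∃ (c : ℝ) (W : historySpace U ħ ψ ≃ₗᵢ[ℂ] L2), 0 < c ∧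
      (∀ t, W ((c : ℂ) • hF.curve t) = step t) ∧
      ∀ t x, W ((U.restrict hF.op_mem_historySpace).op t x) = translationGroup.op t (W x) := by
  have hpos : 0 < ‖F 1‖ := norm_pos_iff.2 (hF.apply_one_ne_zero hψ hδ)
  have hc : ((‖F 1‖⁻¹ : ℝ) : ℂ) ≠ 0 := Complex.ofReal_ne_zero.2 (inv_ne_zero hpos.ne')
  obtain ⟨W, hW, hWU⟩ := (hF.isCocycle_curve.const_smul _).exists_intertwining isCocycle_step
    (hF.isTotal_range_curve.range_const_smul hc) isTotal_range_step fun s t => by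
      rw [inner_smul_left, inner_smul_right, Submodule.coe_inner, Complex.conj_ofReal,
        inner_step_step]
      change _ * (_ * ⟪F s, F t⟫_ℂ) = _
      rw [hF.isCocycle.inner_eq hF.continuous hδ, ← Complex.ofReal_mul, ← Complex.ofReal_mul]
      congr 1
      field_simp
  exact ⟨_, W, inv_pos.2 hpos, hW, hWU⟩

end IsHistoryPrimitive

end HistoryPrimitives

section GeneralizedEigenvectors

variable {H : Type*} [NormedAddCommGroup H] [InnerProductSpace ℂ H] {A : H →ₗ.[ℂ] H}
  {V : Submodule ℂ H} {T : V →ₗ.[ℂ] V} {W : V ≃ₗᵢ[ℂ] L2} {χ : ℝ → GeneralizedVector A} {c : ℝ}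

theorem Represents.symm_mem_domain {B : L2 →ₗ.[ℂ] L2} (hA : Represents W (restrictTo A V) B)
    {f g : L2} (hfg : (f, g) ∈ B.graph) : (W.symm f : H) ∈ A.domain :=
  LinearPMap.mem_domain_of_mem_graph ((mem_graph_restrictTo A V _ _).1 (hA.symm_mem_graph hfg))

variable (hcont : ∀ φ, Continuous fun τ => (χ τ).pair φ)
  (hrep : ∀ (φ : V) (hφ : (φ : H) ∈ A.domain),
    ∀ᵐ τ : ℝ, W φ τ = (c : ℂ) * star ((χ τ).pair ⟨φ, hφ⟩))
include hcont hrep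

theorem eq_mul_star_pair_of_ae_eq {φ : V} (hφ : (φ : H) ∈ A.domain) {g : ℝ → ℂ}
    (hg : Continuous g) (h : W φ =ᵐ[volume] g) (τ : ℝ) :
    g τ = (c : ℂ) * star ((χ τ).pair ⟨φ, hφ⟩) := by
  refine congrFun ((Continuous.ae_eq_iff_eq volume hg ?_).1 (h.symm.trans (hrep φ hφ))) τ
  exact continuous_const.mul (hcont _).star

theorem pair_eq_mul_pair (hT : Represents W T positionOperator) (hc : c ≠ 0) {φ Tφ : V}
    (hgraph : (φ, Tφ) ∈ T.graph) (hφ : (φ : H) ∈ A.domain) (hTφ : (Tφ : H) ∈ A.domain) (τ : ℝ) :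
    (χ τ).pair ⟨Tφ, hTφ⟩ = (τ : ℂ) * (χ τ).pair ⟨φ, hφ⟩ := by
  rw [hT, positionOperator_graph] at hgraph
  have hae : W Tφ =ᵐ[volume]
      fun τ : ℝ => (τ : ℂ) * ((c : ℂ) * star ((χ τ).pair ⟨φ, hφ⟩)) := by
    filter_upwards [(hgraph : ∀ᵐ τ : ℝ, W Tφ τ = (τ : ℂ) * W φ τ), hrep φ hφ] with τ hmul hφτ
    rw [hmul, hφτ]
  have heq : (τ : ℂ) * ((c : ℂ) * star ((χ τ).pair ⟨φ, hφ⟩)) =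
      (c : ℂ) * star ((χ τ).pair ⟨Tφ, hTφ⟩) :=
    eq_mul_star_pair_of_ae_eq hcont hrep hTφ
      (Complex.continuous_ofReal.mul (continuous_const.mul (hcont _).star)) hae τ
  rw [mul_left_comm] at heq
  refine star_injective ?_
  rw [← mul_left_cancel₀ (Complex.ofReal_ne_zero.2 hc) heq, star_mul', Complex.star_def,
    Complex.conj_ofReal]

theorem exists_pair_ne_zero {ħ : ℝ} (hA : Represents W (restrictTo A V) (translationHamiltonian ħ))
    (hT : Represents W T positionOperator) (τ : ℝ) :
    ∃ (φ Tφ : V) (_ : (φ, Tφ) ∈ T.graph) (hφ : (φ : H) ∈ A.domain) (_ : (Tφ : H) ∈ A.domain),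
      (χ τ).pair ⟨φ, hφ⟩ ≠ 0 := by
  let η : ContDiffBump τ := default
  obtain ⟨f, hf, hfη⟩ := exists_isTest_coeFn (g := fun x => (η x : ℂ))
    (η.hasCompactSupport.comp_left (g := Complex.ofReal) Complex.ofReal_zero)
    (Complex.ofRealCLM.contDiff.comp η.contDiff)
  obtain ⟨p, hp, hfp⟩ := hf.exists_position
  obtain ⟨_, -, hf'⟩ := hf.exists_translation ħ
  obtain ⟨_, -, hp'⟩ := hp.exists_translation ħ
  refine ⟨W.symm f, W.symm p, hT.symm_mem_graph hfp, hA.symm_mem_domain hf',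
    hA.symm_mem_domain hp', fun hzero => ?_⟩
  have hη : (η τ : ℂ) = (c : ℂ) * star ((χ τ).pair ⟨W.symm f, hA.symm_mem_domain hf'⟩) :=
    eq_mul_star_pair_of_ae_eq hcont hrep (hA.symm_mem_domain hf')
      (Complex.continuous_ofReal.comp η.continuous) (by rwa [W.apply_symm_apply]) τ
  rw [hzero, star_zero, mul_zero,
    η.one_of_mem_closedBall (Metric.mem_closedBall_self η.rIn_pos.le)] at hη
  exact one_ne_zero (Complex.ofReal_eq_zero.1 hη)

theorem isGeneralizedEigenvector_of_ae_eq {ħ : ℝ}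
    (hA : Represents W (restrictTo A V) (translationHamiltonian ħ))
    (hT : Represents W T positionOperator) (hc : c ≠ 0) (τ : ℝ) :
    IsGeneralizedEigenvector T (χ τ) τ :=
  ⟨exists_pair_ne_zero hcont hrep hA hT τ,
    fun _ _ hgraph hφ hTφ => pair_eq_mul_pair hcont hrep hT hc hgraph hφ hTφ τ⟩

end GeneralizedEigenvectors

section HistoryRepresentation

variable {H : Type*} [NormedAddCommGroup H] [InnerProductSpace ℂ H] [CompleteSpace H] {ħ : ℝ}
  {U : UnitaryGroup H} {ψ : GeneralizedVector (U.hamiltonian ħ)} {F : ℝ → H}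

theorem IsHistoryPrimitive.coeFn_ae_eq (hF : IsHistoryPrimitive U ħ ψ F) {c : ℝ}
    {W : historySpace U ħ ψ ≃ₗᵢ[ℂ] L2} (hW : ∀ t, W ((c : ℂ) • hF.curve t) = step t)
    (φ : historySpace U ħ ψ) (hφ : (φ : H) ∈ (U.hamiltonian ħ).domain) :
    ∀ᵐ τ : ℝ, W φ τ = (c : ℂ) * star ((U.evolve ħ ψ τ).pair ⟨φ, hφ⟩) := by
  have hloc := locallyIntegrable_coeFn (W φ)
  have hcont : Continuous fun τ : ℝ => (c : ℂ) * star ((U.evolve ħ ψ τ).pair ⟨φ, hφ⟩) :=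
    continuous_const.mul (continuous_evolve_pair ψ _).star
  have hprimitive (t : ℝ) : ∫ τ in (0 : ℝ)..t, W φ τ =
      ∫ τ in (0 : ℝ)..t, (c : ℂ) * star ((U.evolve ħ ψ τ).pair ⟨φ, hφ⟩) :=
    calc ∫ τ in (0 : ℝ)..t, W φ τ = ⟪(c : ℂ) • hF.curve t, φ⟫_ℂ := by
          rw [← inner_step_left, ← hW, W.inner_map_map]
      _ = (c : ℂ) * star ⟪(φ : H), F t⟫_ℂ := by
          rw [inner_smul_left, Complex.conj_ofReal, Complex.star_def, inner_conj_symm]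
          rfl
      _ = _ := by
          rw [hF.isHistoryIntegral t ⟨φ, hφ⟩, intervalIntegral.integral_const_mul]
          exact congrArg _ (Complex.conjCLE.toContinuousLinearMap.intervalIntegral_comp_comm
            ((continuous_evolve_pair ψ _).intervalIntegrable 0 t)).symm
  have hzero := ae_eq_zero_of_intervalIntegral_eq_zero (a := 0)
    (hloc.sub hcont.locallyIntegrable) fun t => by
      simp only [Pi.sub_apply]
      rw [intervalIntegral.integral_sub
        (hloc.integrableOn_isCompact isCompact_uIcc).intervalIntegrable
        (hcont.intervalIntegrable 0 t), hprimitive, sub_self]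
  filter_upwards [hzero] with τ hτ
  exact sub_eq_zero.1 hτ

end HistoryRepresentation

end TimeOp

end

theorem corollary1 {H : Type*} [NormedAddCommGroup H] [InnerProductSpace ℂ H] [CompleteSpace H]
    (ħ : ℝ) (hħ : 0 < ħ) (U : TimeOp.UnitaryGroup H)
    (ψ : TimeOp.GeneralizedVector (U.hamiltonian ħ)) (hψ : ψ.pair ≠ 0)
    (hdist : (∀ t < 0, TimeOp.Distinguishable U ħ (U.evolve ħ ψ t) (U.evolve ħ ψ 0)) ∨
      (∀ t > 0, TimeOp.Distinguishable U ħ (U.evolve ħ ψ t) (U.evolve ħ ψ 0))) :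
    (∀ t, ∀ x ∈ TimeOp.historySpace U ħ ψ, U.op t x ∈ TimeOp.historySpace U ħ ψ) ∧
    (∀ x : (U.hamiltonian ħ).domain, (x : H) ∈ TimeOp.historySpace U ħ ψ →
      U.hamiltonian ħ x ∈ TimeOp.historySpace U ħ ψ) ∧
    ∃ (W : TimeOp.historySpace U ħ ψ ≃ₗᵢ[ℂ] TimeOp.L2)
      (T : TimeOp.historySpace U ħ ψ →ₗ.[ℂ] TimeOp.historySpace U ħ ψ) (c : ℝ),
      0 < c ∧
      -- `W` is the representation of a vector by its components along the states `ψ(τ)`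
      (∀ (φ : TimeOp.historySpace U ħ ψ) (hφ : (φ : H) ∈ (U.hamiltonian ħ).domain),
        ∀ᵐ τ : ℝ, W φ τ = (c : ℂ) * star ((U.evolve ħ ψ τ).pair ⟨φ, hφ⟩)) ∧
      TimeOp.Represents W (TimeOp.restrictTo (U.hamiltonian ħ) (TimeOp.historySpace U ħ ψ))
        (TimeOp.translationHamiltonian ħ) ∧
      TimeOp.Represents W T TimeOp.positionOperator ∧
      TimeOp.IsCanonicalConjugate ħ T
        (TimeOp.restrictTo (U.hamiltonian ħ) (TimeOp.historySpace U ħ ψ)) ∧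
      ∀ τ : ℝ, TimeOp.IsGeneralizedEigenvector T (U.evolve ħ ψ τ) τ := by
  have hħ0 : ħ ≠ 0 := hħ.ne'
  obtain ⟨F, hF⟩ := TimeOp.exists_isHistoryPrimitive hħ0 ψ
  obtain ⟨c, W, hc, hW, hWU⟩ := hF.exists_representation hψ (hF.deltaCorrelated hdist)
  have hV := hF.op_mem_historySpace
  have hA : TimeOp.Represents W
      (TimeOp.restrictTo (U.hamiltonian ħ) (TimeOp.historySpace U ħ ψ))
      (TimeOp.translationHamiltonian ħ) := by
    rw [← TimeOp.UnitaryGroup.hamiltonian_restrict hħ0 U hV,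
      ← TimeOp.hamiltonian_translationGroup hħ0]
    exact TimeOp.UnitaryGroup.represents_hamiltonian hħ0 hWU
  have hT := TimeOp.represents_pullbackOperator W TimeOp.positionOperator
  have hrep := hF.coeFn_ae_eq hW
  exact ⟨hV,
    TimeOp.UnitaryGroup.hamiltonian_mem_of_isClosed ħ U hV
      (Submodule.isClosed_topologicalClosure _),
    W, _, c, hc, hrep, hA, hT,
    (TimeOp.isCanonicalConjugate_position_translation hħ0).of_represents hħ0 hT hA,
    TimeOp.isGeneralizedEigenvector_of_ae_eq (TimeOp.continuous_evolve_pair ψ) hrep hA hT hc.ne'⟩
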